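/- Let $(X,d,m)$ be a metric measure space: $(X,d)$ is a complete separable metric space and $m$ is a Borel measure that is finite on bounded sets. For a Borel measure $\nu$ on $X$, a function $f\colon X\to\mathbb R$ and an open set $A\subset X$ put $$|Df|_\nu(A)=\inf\Big\{\liminf_{n\to\infty}\int_A \mathrm{lip}_a(f_n)\,d\nu \;:\; f_n\in \mathrm{LIP}_{loc}(A),\ f_n\to f \text{ in } L^1_{loc}(\nu|_A)\Big\},$$ where $\mathrm{lip}_a(g)(x)=\inf_{r>0}\mathrm{Lip}(g|_{B_r(x)})$, and where "locally" means: on some ball around each point of $A$. For a Borel set $B$ put $|Df|_\nu(B)=\inf\{|Df|_\nu(A): A\supset B \text{ open}\}$. For a Borel set $B$ write $|Df|_B=|Df|_{m|_B}$, and let $BV(B)$ be the space of all $f\in L^1(m|_B)$ with $|Df|_B(B)<\infty$, with the norm $\|f\|_{BV(B)}=\|f\|_{L^1(m|_B)}+|Df|_B(B)$. Put $\mathrm{Per}(E)=|D\chi_E|_X(X)$. Let $\Omega\subset X$ be a bounded open set. For $\lambda>0$ and closed $A\subset\Omega$ put $M_\lambda(A)=\mathrm{Per}(A)+\lambda\,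 m(\Omega\setminus A)$. On the family of closed sets $A\subset\Omega$ with $M_\lambda(A)<\infty$, write $A\prec_\lambda A'$ if $m(A\setminus A')=0$ and $M_\lambda(A)\le M_\lambda(A')$; a set $G$ of this family is called minimal if $A\prec_\lambda G$ implies $G\prec_\lambda A$, for all $A$ in the family. **Theorem.** For every $\varepsilon>0$ there is a closed set $G\subset\Omega$ with $m(\Omega\setminus G)<\varepsilon$ such that zero extension is a bounded operator from $BV(G)$ to $BV(X)$. More precisely, $G$ can be chosen so that, for some $\lambda>0$, $G$ is minimal for $\prec_\lambda$ and, for every $f\in BV(G)$, the extension $E_Gf$ of $f$ by zero outside $G$ belongs to $BV(X)$ and satisfies $$\|E_Gf\|_{BV(X)}\le \max\{2,\lambda+1\}\,\|f\|_{BV(G)} .$$ -/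

import Mathlib

open Set Filter Topology MeasureTheory Metric
open scoped NNReal ENNReal

namespace MetricBV

noncomputable section

/-- The Lipschitz constant `Lip(f; E)` of the restriction of `f` to `E`
(equal to `∞` if this restriction is not Lipschitz). -/
def lipConstOn {X : Type*} [MetricSpace X] (f : X → ℝ) (E : Set X) : ℝ≥0∞ :=
  ⨅ (K : ℝ≥0) (_ : LipschitzOnWith K f E), (K : ℝ≥0∞)

/-- The asymptotic Lipschitz constant `lip_a(f)(x) = inf_{r > 0} Lip(f; B_r(x))`. -/
def asympLip {X : Type*} [MetricSpace X] (f : X → ℝ) (x : X) : ℝ≥0∞ :=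
  ⨅ (r : ℝ) (_ : 0 < r), lipConstOn f (ball x r)

/-- Convergence `u n → f` in `L¹_loc` of the measure `ν` restricted to the open set `A`: every point
of `A` has a ball around it on which the convergence holds in `L¹(ν)`. -/
def TendstoL1LocOn {X : Type*} [MetricSpace X] [MeasurableSpace X]
    (ν : Measure X) (A : Set X) (u : ℕ → X → ℝ) (f : X → ℝ) : Prop :=
  ∀ x ∈ A, ∃ r : ℝ, 0 < r ∧
    Tendsto (fun n => ∫⁻ y in ball x r, ‖u n y - f y‖ₑ ∂ν) atTop (𝓝 0)

/-- The total variation of `f` on an open set `A`, in the metric measure space `(X, d, ν)`. Only the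
values on `A` of the competitors `u n` matter. -/
def totalVariationOpen {X : Type*} [MetricSpace X] [MeasurableSpace X]
    (ν : Measure X) (f : X → ℝ) (A : Set X) : ℝ≥0∞ :=
  ⨅ (u : ℕ → X → ℝ) (_ : (∀ n, LocallyLipschitzOn A (u n)) ∧ TendstoL1LocOn ν A u f),
    liminf (fun n => ∫⁻ x in A, asympLip (u n) x ∂ν) atTop

/-- The total variation `|Df|(B)` of `f` on a Borel set `B`, in the metric measure space `(X, d, ν)`:
the infimum of the total variations on the open sets that contain `B`. -/
def totalVariation {X : Type*} [MetricSpace X] [MeasurableSpace X]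
    (ν : Measure X) (f : X → ℝ) (B : Set X) : ℝ≥0∞ :=
  ⨅ (A : Set X) (_ : IsOpen A ∧ B ⊆ A), totalVariationOpen ν f A

/-- Membership in `BV(B)`: `f ∈ L¹(μ|_B)` and `|Df|_B(B) < ∞`, where `|Df|_B` is computed in the
metric measure space `(X, d, μ|_B)`. This only depends on the `μ|_B`-a.e. class of `f`. -/
def MemBV {X : Type*} [MetricSpace X] [MeasurableSpace X]
    (μ : Measure X) (B : Set X) (f : X → ℝ) : Prop :=
  Integrable f (μ.restrict B) ∧ totalVariation (μ.restrict B) f B < ∞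

/-- The norm `‖f‖_{BV(B)} = ‖f‖_{L¹(μ|_B)} + |Df|_B(B)`. -/
def bvNorm {X : Type*} [MetricSpace X] [MeasurableSpace X]
    (μ : Measure X) (B : Set X) (f : X → ℝ) : ℝ≥0∞ :=
  eLpNorm f 1 (μ.restrict B) + totalVariation (μ.restrict B) f B

/-- The perimeter `Per_B(E) = |Dχ_E|_B(B)`; the perimeter `Per(E)` is the case `B = univ`. -/
def perimeter {X : Type*} [MetricSpace X] [MeasurableSpace X]
    (μ : Measure X) (B E : Set X) : ℝ≥0∞ :=
  totalVariation (μ.restrict B) (E.indicator fun _ => (1 : ℝ)) B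

/-- The functional `M_λ(A) = Per(A) + λ μ(Ω \ A)`. -/
def perimeterFunctional {X : Type*} [MetricSpace X] [MeasurableSpace X]
    (μ : Measure X) (Ω : Set X) (lam : ℝ≥0) (A : Set X) : ℝ≥0∞ :=
  perimeter μ univ A + (lam : ℝ≥0∞) * μ (Ω \ A)

/-- The closed subsets `A` of `Ω` with `M_λ(A) < ∞`. -/
def competitors {X : Type*} [MetricSpace X] [MeasurableSpace X]
    (μ : Measure X) (Ω : Set X) (lam : ℝ≥0) : Set (Set X) :=
  {A | IsClosed A ∧ A ⊆ Ω ∧ perimeterFunctional μ Ω lam A < ∞}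

/-- The order `A ≺_λ B`: `μ(A \ B) = 0` and `M_λ(A) ≤ M_λ(B)`. It is a partial order up to sets of
measure zero. -/
def Prec {X : Type*} [MetricSpace X] [MeasurableSpace X]
    (μ : Measure X) (Ω : Set X) (lam : ℝ≥0) (A B : Set X) : Prop :=
  μ (A \ B) = 0 ∧ perimeterFunctional μ Ω lam A ≤ perimeterFunctional μ Ω lam B

/-- `G` is a minimal element of the competitors for the order `≺_λ`. -/
def IsMinimalElement {X : Type*} [MetricSpace X] [MeasurableSpace X]
    (μ : Measure X) (Ω : Set X) (lam : ℝ≥0) (G : Set X) : Prop :=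
  G ∈ competitors μ Ω lam ∧
    ∀ A ∈ competitors μ Ω lam, Prec μ Ω lam A G → Prec μ Ω lam G A

end

end MetricBV

/-! Choose a closed `A ⊆ Ω` of finite perimeter with `μ (Ω \ A) < ε / 2`; a superlevel set of the
distance to the complement of `Ω` will do (`exists_closed_perimeter_lt_top`). Take `λ` so large that
`Per(A) ≤ λ ε / 2`, and let `G` be a minimal element with `M_λ(G) ≤ M_λ(A)`
(`exists_isMinimalElement`). This inequality alone gives `μ (Ω \ G) < ε`.

Minimality yields `Per(G) ≤ Per(F) + λ μ (G \ F)` for every closed `F ⊆ G`. Let `u` be locally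
Lipschitz near `G` with values in `[0, 1]`. Applying this to `F = G ∩ {u ≤ t}` and integrating over
`t ∈ (0, 1)`, the coarea inequality for `(1 - u) χ_G` (`ApproxBV.exists_levelSet_bound`) and the
layer cake formula give `Per(G) ≤ |D((1 - u) χ_G)| + λ ∫_G u`. Conversely, if `v` approximates
`χ_G`, then `u v` and `(1 - u) v` approximate the two pieces of `χ_G`. By the Leibniz rule their
energies add up to at most `∫ lip_a(v) + 2 ∫_G lip_a(u)` and an error (`exists_approx_pair`). So,
informally, `|D(u χ_G)| + |D((1 - u) χ_G)| ≤ Per(G) + 2 ∫_G lip_a(u)`. Since `Per(G)` is finite it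
cancels, leaving `|D(u χ_G)| ≤ 2 ∫_G lip_a(u) + λ ∫_G u` (`IsMinimalElement.approxBV_indicator`).
The factor 2 arises because `u` and `1 - u` each contribute `lip_a(u)`.

The Leibniz error is `∫ (lip_a(U) + lip_a(V)) |v - χ_G|`, where `U` and `V` are cut-off versions of
`u` and `1 - u`. Its weight is only locally bounded, so `v` must approximate `χ_G` in a weighted
`L¹` space; gluing with a partition of unity achieves this (`ApproxBV.exists_weighted`). Scaling, a
splitting into signs and truncation then lead to general `f`
(`IsMinimalElement.approxBV_extension`). -/

namespace MetricBV

/-! ### Calculus of the asymptotic Lipschitz constant. -/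

section AsympLip

variable {X : Type*} [MetricSpace X] {f g : X → ℝ} {x : X}

lemma asympLip_le_of_mem_nhds {K : ℝ≥0} {s : Set X} (hs : s ∈ 𝓝 x)
    (hf : LipschitzOnWith K f s) : asympLip f x ≤ K := by
  obtain ⟨r, hr, hrs⟩ := Metric.mem_nhds_iff.1 hs
  exact (iInf₂_le r hr).trans (iInf₂_le K (hf.mono hrs))

lemma exists_ball_lipschitzOnWith {K : ℝ≥0∞} (h : asympLip f x < K) :
    ∃ r : ℝ, 0 < r ∧ ∃ L : ℝ≥0, (L : ℝ≥0∞) < K ∧ LipschitzOnWith L f (ball x r) := by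
  simp only [asympLip, lipConstOn, iInf_lt_iff] at h
  obtain ⟨r, hr, L, hL, hLK⟩ := h
  exact ⟨r, hr, L, hLK, hL⟩

lemma exists_lipschitzOnWith {K : ℝ≥0} (h : asympLip f x < K) :
    ∃ s ∈ 𝓝 x, LipschitzOnWith K f s := by
  obtain ⟨r, hr, L, hL, hLf⟩ := exists_ball_lipschitzOnWith h
  exact ⟨ball x r, ball_mem_nhds x hr, hLf.weaken (by exact_mod_cast hL.le)⟩

lemma asympLip_lt_top_iff :
    asympLip f x < ∞ ↔ ∃ K : ℝ≥0, ∃ s ∈ 𝓝 x, LipschitzOnWith K f s := by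
  constructor
  · intro h
    obtain ⟨r, hr, L, -, hL⟩ := exists_ball_lipschitzOnWith h
    exact ⟨L, _, ball_mem_nhds x hr, hL⟩
  · rintro ⟨K, s, hs, hK⟩
    exact (asympLip_le_of_mem_nhds hs hK).trans_lt ENNReal.coe_lt_top

lemma locallyLipschitz_iff : LocallyLipschitz f ↔ ∀ x, asympLip f x < ∞ := by
  simp only [asympLip_lt_top_iff]; rfl

lemma locallyLipschitzOn_iff {A : Set X} (hA : IsOpen A) :
    LocallyLipschitzOn A f ↔ ∀ x ∈ A, asympLip f x < ∞ := by
  simp only [asympLip_lt_top_iff]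
  constructor
  · intro h x hx
    obtain ⟨K, t, ht, hK⟩ := h hx
    exact ⟨K, t, by rwa [hA.nhdsWithin_eq hx] at ht, hK⟩
  · intro h x hx
    obtain ⟨K, t, ht, hK⟩ := h x hx
    exact ⟨K, t, mem_nhdsWithin_of_mem_nhds ht, hK⟩

lemma continuousAt_of_asympLip (h : asympLip f x < ∞) : ContinuousAt f x := by
  obtain ⟨K, s, hs, hK⟩ := asympLip_lt_top_iff.1 h
  exact hK.continuousOn.continuousAt hs

lemma asympLip_congr (h : f =ᶠ[𝓝 x] g) : asympLip f x = asympLip g x := by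
  have key : ∀ {f g : X → ℝ}, f =ᶠ[𝓝 x] g → asympLip f x ≤ asympLip g x := by
    intro f g h
    refine le_of_forall_gt fun K hK => ?_
    obtain ⟨r, hr, L, hL, hLg⟩ := exists_ball_lipschitzOnWith hK
    refine (asympLip_le_of_mem_nhds (inter_mem (ball_mem_nhds x hr) h) (K := L) ?_).trans_lt hL
    intro y hy z hz
    have hy' : f y = g y := hy.2
    have hz' : f z = g z := hz.2
    rw [hy', hz']
    exact hLg hy.1 hz.1
  exact le_antisymm (key h) (key h.symm)

/-- A Lipschitz bound on a ball serves every point of the ball, so `asympLip f` is upper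
semicontinuous. -/
lemma measurable_asympLip [MeasurableSpace X] [OpensMeasurableSpace X] (f : X → ℝ) :
    Measurable (asympLip f) := by
  refine measurable_of_Iio fun K => IsOpen.measurableSet ?_
  rw [Metric.isOpen_iff]
  intro x hx
  obtain ⟨r, hr, L, hL, hLf⟩ := exists_ball_lipschitzOnWith (mem_Iio.1 hx)
  exact ⟨r, hr, fun y hy => (asympLip_le_of_mem_nhds (isOpen_ball.mem_nhds hy) hLf).trans_lt hL⟩

lemma asympLip_const (c : ℝ) : asympLip (fun _ : X => c) x = 0 :=
  le_antisymm (asympLip_le_of_mem_nhds (K := 0) univ_mem (LipschitzWith.const c).lipschitzOnWith)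
    zero_le

lemma asympLip_le_of_lipschitzWith {K : ℝ≥0} (hf : LipschitzWith K f) : asympLip f x ≤ K :=
  asympLip_le_of_mem_nhds univ_mem hf.lipschitzOnWith

lemma LipschitzWith.asympLip_lt_top {K : ℝ≥0} (hf : LipschitzWith K f) : asympLip f x < ∞ :=
  (asympLip_le_of_lipschitzWith hf).trans_lt ENNReal.coe_lt_top

lemma asympLip_eq_zero_of_eventuallyEq {c : ℝ} (h : ∀ᶠ y in 𝓝 x, f y = c) : asympLip f x = 0 :=
  (asympLip_congr h).trans (asympLip_const c)

lemma exists_lipschitzOnWith_add (h : asympLip f x < ∞) {ε : ℝ≥0} (hε : 0 < ε) :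
    ∃ s ∈ 𝓝 x, LipschitzOnWith ((asympLip f x).toNNReal + ε) f s := by
  apply exists_lipschitzOnWith
  rw [ENNReal.coe_add, ENNReal.coe_toNNReal h.ne]
  exact ENNReal.lt_add_right h.ne (by simpa using hε.ne')

lemma asympLip_comp_le {φ : ℝ → ℝ} {K : ℝ≥0} (hφ : LipschitzWith K φ) (hf : asympLip f x < ∞) :
    asympLip (fun y => φ (f y)) x ≤ K * asympLip f x := by
  have key : ∀ ε : ℝ≥0, 0 < ε →
      asympLip (fun y => φ (f y)) x ≤ ((K * ((asympLip f x).toNNReal + ε) : ℝ≥0) : ℝ≥0∞) := by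
    intro ε hε
    obtain ⟨s, hs, hL⟩ := exists_lipschitzOnWith_add hf hε
    exact asympLip_le_of_mem_nhds hs (hφ.comp_lipschitzOnWith hL)
  have hlim : Tendsto (fun ε : ℝ≥0 => ((K * ((asympLip f x).toNNReal + ε) : ℝ≥0) : ℝ≥0∞))
      (𝓝[>] 0) (𝓝 ((K * ((asympLip f x).toNNReal + 0) : ℝ≥0) : ℝ≥0∞)) := by
    refine ((ENNReal.continuous_coe.comp ?_).tendsto _).mono_left nhdsWithin_le_nhds
    fun_prop
  have := ge_of_tendsto hlim (eventually_mem_nhdsWithin.mono fun ε hε => key ε hε)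
  rwa [add_zero, ENNReal.coe_mul, ENNReal.coe_toNNReal hf.ne] at this

lemma asympLip_add_le (hf : asympLip f x < ∞) (hg : asympLip g x < ∞) :
    asympLip (fun y => f y + g y) x ≤ asympLip f x + asympLip g x := by
  have key : ∀ ε : ℝ≥0, 0 < ε → asympLip (fun y => f y + g y) x ≤
      (((asympLip f x).toNNReal + ε + ((asympLip g x).toNNReal + ε) : ℝ≥0) : ℝ≥0∞) := by
    intro ε hε
    obtain ⟨s, hs, hL⟩ := exists_lipschitzOnWith_add hf hε
    obtain ⟨t, ht, hM⟩ := exists_lipschitzOnWith_add hg hε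
    exact asympLip_le_of_mem_nhds (inter_mem hs ht)
      ((hL.mono inter_subset_left).add (hM.mono inter_subset_right))
  have hlim : Tendsto (fun ε : ℝ≥0 =>
      (((asympLip f x).toNNReal + ε + ((asympLip g x).toNNReal + ε) : ℝ≥0) : ℝ≥0∞))
      (𝓝[>] 0) (𝓝 (((asympLip f x).toNNReal + 0 + ((asympLip g x).toNNReal + 0) : ℝ≥0) :
        ℝ≥0∞)) := by
    refine ((ENNReal.continuous_coe.comp ?_).tendsto _).mono_left nhdsWithin_le_nhds
    fun_prop
  have := ge_of_tendsto hlim (eventually_mem_nhdsWithin.mono fun ε hε => key ε hε)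
  rwa [add_zero, add_zero, ENNReal.coe_add, ENNReal.coe_toNNReal hf.ne,
    ENNReal.coe_toNNReal hg.ne] at this

/-- By continuity at `x`, the values of the factors on a small ball exceed those at `x` by at most
`ε`; hence only values at the point itself enter the Leibniz rule. -/
lemma asympLip_mul_le (hf : asympLip f x < ∞) (hg : asympLip g x < ∞) :
    asympLip (fun y => f y * g y) x ≤ ‖f x‖ₑ * asympLip g x + ‖g x‖ₑ * asympLip f x := by
  have key : ∀ ε : ℝ≥0, 0 < ε → asympLip (fun y => f y * g y) x ≤
      (((‖f x‖₊ + ε) * ((asympLip g x).toNNReal + ε) +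
        (‖g x‖₊ + ε) * ((asympLip f x).toNNReal + ε) : ℝ≥0) : ℝ≥0∞) := by
    intro ε hε
    obtain ⟨s, hs, hL⟩ := exists_lipschitzOnWith_add hf hε
    obtain ⟨t, ht, hM⟩ := exists_lipschitzOnWith_add hg hε
    have hf' : ∀ᶠ y in 𝓝 x, ‖f y‖₊ < ‖f x‖₊ + ε :=
      (continuousAt_of_asympLip hf).nnnorm.eventually_lt_const (lt_add_of_pos_right _ hε)
    have hg' : ∀ᶠ y in 𝓝 x, ‖g y‖₊ < ‖g x‖₊ + ε :=
      (continuousAt_of_asympLip hg).nnnorm.eventually_lt_const (lt_add_of_pos_right _ hε)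
    refine asympLip_le_of_mem_nhds (inter_mem (inter_mem hs ht) (inter_mem hf' hg')) ?_
    refine LipschitzOnWith.of_dist_le_mul fun y hy z hz => ?_
    have h1 : |f y - f z| ≤ ((asympLip f x).toNNReal + ε : ℝ≥0) * dist y z := by
      simpa [Real.dist_eq] using hL.dist_le_mul y hy.1.1 z hz.1.1
    have h2 : |g y - g z| ≤ ((asympLip g x).toNNReal + ε : ℝ≥0) * dist y z := by
      simpa [Real.dist_eq] using hM.dist_le_mul y hy.1.2 z hz.1.2
    have h3 : |f y| ≤ (‖f x‖₊ + ε : ℝ≥0) := by exact_mod_cast (le_of_lt hy.2.1 : _ ≤ _)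
    have h4 : |g z| ≤ (‖g x‖₊ + ε : ℝ≥0) := by exact_mod_cast (le_of_lt hz.2.2 : _ ≤ _)
    rw [Real.dist_eq, show f y * g y - f z * g z = f y * (g y - g z) + g z * (f y - f z) by ring]
    refine (abs_add_le _ _).trans ?_
    rw [abs_mul, abs_mul, NNReal.coe_add, add_mul, NNReal.coe_mul, NNReal.coe_mul, mul_assoc,
      mul_assoc]
    gcongr
  have hlim : Tendsto (fun ε : ℝ≥0 => (((‖f x‖₊ + ε) * ((asympLip g x).toNNReal + ε) +
        (‖g x‖₊ + ε) * ((asympLip f x).toNNReal + ε) : ℝ≥0) : ℝ≥0∞))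
      (𝓝[>] 0) (𝓝 (((‖f x‖₊ + 0) * ((asympLip g x).toNNReal + 0) +
        (‖g x‖₊ + 0) * ((asympLip f x).toNNReal + 0) : ℝ≥0) : ℝ≥0∞)) := by
    refine ((ENNReal.continuous_coe.comp ?_).tendsto _).mono_left nhdsWithin_le_nhds
    fun_prop
  have := ge_of_tendsto hlim (eventually_mem_nhdsWithin.mono fun ε hε => key ε hε)
  simp only [add_zero, ENNReal.coe_add, ENNReal.coe_mul, ENNReal.coe_toNNReal hf.ne,
    ENNReal.coe_toNNReal hg.ne] at this
  exact this

lemma asympLip_sum_le {ι : Type*} (s : Finset ι) (F : ι → X → ℝ)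
    (hF : ∀ i ∈ s, asympLip (F i) x < ∞) :
    asympLip (fun y => ∑ i ∈ s, F i y) x ≤ ∑ i ∈ s, asympLip (F i) x := by
  classical
  induction s using Finset.induction_on with
  | empty => simp [asympLip_const]
  | insert a s ha ih =>
    simp only [Finset.sum_insert ha]
    have ih' := ih fun i hi => hF i (Finset.mem_insert_of_mem hi)
    have hs : asympLip (fun y => ∑ i ∈ s, F i y) x < ∞ := ih'.trans_lt
      (ENNReal.sum_lt_top.2 fun i hi => hF i (Finset.mem_insert_of_mem hi))
    exact (asympLip_add_le (hF a (Finset.mem_insert_self a s)) hs).trans (by gcongr)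

lemma asympLip_const_mul_le (c : ℝ) (hf : asympLip f x < ∞) :
    asympLip (fun y => c * f y) x ≤ ‖c‖ₑ * asympLip f x := by
  have := asympLip_mul_le (f := fun _ => c) (by simp [asympLip_const]) hf
  simpa [asympLip_const] using this

lemma asympLip_add_const_le (c : ℝ) (hf : asympLip f x < ∞) :
    asympLip (fun y => f y + c) x ≤ asympLip f x := by
  have := asympLip_add_le (g := fun _ => c) hf (by simp [asympLip_const])
  simpa [asympLip_const] using this

lemma asympLip_comp_le_of_one {φ : ℝ → ℝ} (hφ : LipschitzWith 1 φ) (hf : asympLip f x < ∞) :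
    asympLip (fun y => φ (f y)) x ≤ asympLip f x := by
  simpa using asympLip_comp_le hφ hf

lemma _root_.LocallyLipschitz.asympLip_lt_top (hf : LocallyLipschitz f) (x : X) :
    asympLip f x < ∞ := locallyLipschitz_iff.1 hf x

end AsympLip

/-! ### Approximation with controlled energy, and its relation to total variation. -/

/-- `g` can be approximated, in `L¹` on bounded sets, by locally Lipschitz functions `w` on the whole
space with `∫ lip_a(w) ≤ C + o(1)`. -/
def ApproxBV {X : Type*} [MetricSpace X] [MeasurableSpace X] (μ : Measure X) (g : X → ℝ)
    (C : ℝ≥0∞) : Prop :=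
  ∀ B : Set X, Bornology.IsBounded B → ∀ δ : ℝ≥0∞, 0 < δ → ∃ w : X → ℝ, LocallyLipschitz w ∧
    ∫⁻ x in B, ‖w x - g x‖ₑ ∂μ ≤ δ ∧ ∫⁻ x, asympLip w x ∂μ ≤ C + δ

section ApproxBV

variable {X : Type*} [MetricSpace X] [MeasurableSpace X] {μ : Measure X} {f g : X → ℝ}
  {C D : ℝ≥0∞}

/-- One sequence serves all bounded sets: its `n`-th member is chosen for the ball of radius `n`
around a fixed point. -/
lemma ApproxBV.exists_seq (h : ApproxBV μ g C) {ε : ℕ → ℝ≥0∞} (hε : ∀ n, 0 < ε n) :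
    ∃ w : ℕ → X → ℝ, (∀ n, LocallyLipschitz (w n)) ∧
      (∀ B : Set X, Bornology.IsBounded B → ∀ᶠ n in atTop, ∫⁻ x in B, ‖w n x - g x‖ₑ ∂μ ≤ ε n) ∧
      ∀ n, ∫⁻ x, asympLip (w n) x ∂μ ≤ C + ε n := by
  rcases isEmpty_or_nonempty X with hX | ⟨⟨x₀⟩⟩
  · choose w hw using fun n => h ∅ Bornology.isBounded_empty (ε n) (hε n)
    refine ⟨w, fun n => (hw n).1, fun B _ => Eventually.of_forall fun n => ?_, fun n => (hw n).2.2⟩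
    simp [Measure.eq_zero_of_isEmpty μ]
  · choose w hw using fun n : ℕ => h (ball x₀ n) isBounded_ball (ε n) (hε n)
    refine ⟨w, fun n => (hw n).1, fun B hB => ?_, fun n => (hw n).2.2⟩
    obtain ⟨R, hR⟩ := hB.subset_ball x₀
    filter_upwards [eventually_ge_atTop ⌈R⌉₊] with n hn
    refine (lintegral_mono_set (hR.trans (ball_subset_ball ?_))).trans (hw n).2.1
    exact Nat.ceil_le.1 hn

lemma ApproxBV.mono (h : ApproxBV μ g C) (hCD : C ≤ D) : ApproxBV μ g D := by
  intro B hB δ hδ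
  obtain ⟨w, hw, h1, h2⟩ := h B hB δ hδ
  exact ⟨w, hw, h1, h2.trans (by gcongr)⟩

lemma ApproxBV.totalVariation_le (h : ApproxBV μ g C) :
    totalVariation (μ.restrict univ) g univ ≤ C := by
  obtain ⟨w, hw, h1, h2⟩ := h.exists_seq (ε := fun n => ((n : ℝ≥0∞) + 1)⁻¹) (by simp)
  have hε : Tendsto (fun n : ℕ => ((n : ℝ≥0∞) + 1)⁻¹) atTop (𝓝 0) := by
    have := (tendsto_add_atTop_iff_nat 1).2 ENNReal.tendsto_inv_nat_nhds_zero
    simpa using this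
  have hC : Tendsto (fun n : ℕ => C + ((n : ℝ≥0∞) + 1)⁻¹) atTop (𝓝 C) := by
    simpa using tendsto_const_nhds.add hε
  refine (iInf₂_le univ ⟨isOpen_univ, Subset.rfl⟩).trans ?_
  refine (iInf₂_le w ⟨fun n => (hw n).locallyLipschitzOn, fun x _ => ⟨1, one_pos, ?_⟩⟩).trans ?_
  rotate_left
  · rw [Measure.restrict_univ]
    exact tendsto_of_tendsto_of_tendsto_of_le_of_le' tendsto_const_nhds hε (by simp)
      (h1 _ isBounded_ball)
  · simp only [Measure.restrict_univ]
    rw [← hC.liminf_eq]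
    exact liminf_le_liminf (Eventually.of_forall h2)

variable [BorelSpace X]

omit [MetricSpace X] [BorelSpace X] in
lemma lintegral_enorm_sub_le {a b c : X → ℝ} {ν : Measure X} (ha : AEMeasurable a ν)
    (hb : AEMeasurable b ν) :
    ∫⁻ x, ‖a x - c x‖ₑ ∂ν ≤ ∫⁻ x, ‖a x - b x‖ₑ ∂ν + ∫⁻ x, ‖b x - c x‖ₑ ∂ν := by
  have h : AEMeasurable (fun x => ‖a x - b x‖ₑ) ν := (ha.sub hb).enorm
  rw [← lintegral_add_left' h]
  refine lintegral_mono fun x => ?_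
  calc ‖a x - c x‖ₑ = ‖(a x - b x) + (b x - c x)‖ₑ := by congr 1; ring
    _ ≤ _ := enorm_add_le _ _

/-- A diagonal argument; this is the source of all lower semicontinuity used below. -/
lemma ApproxBV.of_forall_exists (hg : ∀ B : Set X, Bornology.IsBounded B → ∀ δ : ℝ≥0∞, 0 < δ →
    ∃ g' : X → ℝ, AEMeasurable g' μ ∧ ∫⁻ x in B, ‖g' x - g x‖ₑ ∂μ ≤ δ ∧ ApproxBV μ g' (C + δ)) :
    ApproxBV μ g C := by
  intro B hB δ hδ
  have hδ2 : 0 < δ / 2 := ENNReal.half_pos hδ.ne'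
  obtain ⟨g', hg'm, hg', hA⟩ := hg B hB (δ / 2) hδ2
  obtain ⟨w, hw, h1, h2⟩ := hA B hB (δ / 2) hδ2
  refine ⟨w, hw, ?_, ?_⟩
  · calc _ ≤ _ := lintegral_enorm_sub_le hw.continuous.measurable.aemeasurable hg'm.restrict
      _ ≤ δ / 2 + δ / 2 := add_le_add h1 hg'
      _ = δ := ENNReal.add_halves δ
  · rwa [add_assoc, ENNReal.add_halves] at h2

omit [BorelSpace X] in
lemma ApproxBV.congr (h : ApproxBV μ g C) (hfg : g =ᵐ[μ] f) : ApproxBV μ f C := by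
  intro B hB δ hδ
  obtain ⟨w, hw, h1, h2⟩ := h B hB δ hδ
  refine ⟨w, hw, le_of_eq_of_le (lintegral_congr_ae ?_) h1, h2⟩
  filter_upwards [ae_restrict_of_ae hfg] with x hx
  rw [hx]

lemma ApproxBV.add (hf : ApproxBV μ f C) (hg : ApproxBV μ g D) (hfm : AEMeasurable f μ) :
    ApproxBV μ (fun x => f x + g x) (C + D) := by
  intro B hB δ hδ
  have hδ2 : 0 < δ / 2 := ENNReal.half_pos hδ.ne'
  obtain ⟨v, hv, hv1, hv2⟩ := hf B hB (δ / 2) hδ2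
  obtain ⟨w, hw, hw1, hw2⟩ := hg B hB (δ / 2) hδ2
  have hle : ∀ x, asympLip (fun y => v y + w y) x ≤ asympLip v x + asympLip w x := fun x =>
    asympLip_add_le (hv.asympLip_lt_top x) (hw.asympLip_lt_top x)
  refine ⟨fun x => v x + w x, locallyLipschitz_iff.2 fun x => (hle x).trans_lt
    (ENNReal.add_lt_top.2 ⟨hv.asympLip_lt_top x, hw.asympLip_lt_top x⟩), ?_, ?_⟩
  · calc ∫⁻ x in B, ‖v x + w x - (f x + g x)‖ₑ ∂μ
        ≤ ∫⁻ x in B, (‖v x - f x‖ₑ + ‖w x - g x‖ₑ) ∂μ := lintegral_mono fun x => by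
          rw [show v x + w x - (f x + g x) = (v x - f x) + (w x - g x) by ring]
          exact enorm_add_le _ _
      _ = _ := lintegral_add_left'
          (hv.continuous.measurable.aemeasurable.sub hfm.restrict).enorm _
      _ ≤ δ / 2 + δ / 2 := add_le_add hv1 hw1
      _ = δ := ENNReal.add_halves δ
  · calc _ ≤ _ := lintegral_mono hle
      _ = _ := lintegral_add_left (measurable_asympLip v) _
      _ ≤ (C + δ / 2) + (D + δ / 2) := add_le_add hv2 hw2
      _ = C + D + (δ / 2 + δ / 2) := by ring
      _ = _ := by rw [ENNReal.add_halves]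

omit [BorelSpace X] in
lemma ApproxBV.const_mul (hf : ApproxBV μ f C) (c : ℝ) :
    ApproxBV μ (fun x => c * f x) (‖c‖ₑ * C) := by
  intro B hB δ hδ
  -- The added 1 covers `c = 0`.
  have hc : ‖c‖ₑ * (δ / (‖c‖ₑ + 1)) ≤ δ :=
    (mul_le_mul_left (a := δ / (‖c‖ₑ + 1)) (le_self_add : ‖c‖ₑ ≤ ‖c‖ₑ + 1)).trans
      ENNReal.mul_div_le
  have hδ' : 0 < δ / (‖c‖ₑ + 1) := ENNReal.div_pos hδ.ne' (by simp)
  obtain ⟨w, hw, h1, h2⟩ := hf B hB _ hδ'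
  have hle : ∀ x, asympLip (fun y => c * w y) x ≤ ‖c‖ₑ * asympLip w x := fun x =>
    asympLip_const_mul_le c (hw.asympLip_lt_top x)
  refine ⟨fun x => c * w x, locallyLipschitz_iff.2 fun x => (hle x).trans_lt
    (ENNReal.mul_lt_top enorm_lt_top (hw.asympLip_lt_top x)), ?_, ?_⟩
  · calc ∫⁻ x in B, ‖c * w x - c * f x‖ₑ ∂μ = ∫⁻ x in B, ‖c‖ₑ * ‖w x - f x‖ₑ ∂μ := by
          simp only [← mul_sub, enorm_mul]
      _ = ‖c‖ₑ * ∫⁻ x in B, ‖w x - f x‖ₑ ∂μ := lintegral_const_mul' _ _ enorm_ne_top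
      _ ≤ ‖c‖ₑ * (δ / (‖c‖ₑ + 1)) := by gcongr
      _ ≤ δ := hc
  · calc _ ≤ _ := lintegral_mono hle
      _ = ‖c‖ₑ * ∫⁻ x, asympLip w x ∂μ := lintegral_const_mul' _ _ enorm_ne_top
      _ ≤ ‖c‖ₑ * (C + δ / (‖c‖ₑ + 1)) := by gcongr
      _ = ‖c‖ₑ * C + ‖c‖ₑ * (δ / (‖c‖ₑ + 1)) := by ring
      _ ≤ _ := by gcongr

omit [MetricSpace X] [BorelSpace X] in
lemma lintegral_biUnion_finset_le {ι : Type*} (s : Finset ι) (t : ι → Set X) (h : X → ℝ≥0∞)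
    {ν : Measure X} : ∫⁻ x in ⋃ i ∈ s, t i, h x ∂ν ≤ ∑ i ∈ s, ∫⁻ x in t i, h x ∂ν := by
  classical
  induction s using Finset.induction_on with
  | empty => simp
  | insert a s ha ih =>
    rw [Finset.set_biUnion_insert, Finset.sum_insert ha]
    exact (lintegral_union_le _ _ _).trans (by gcongr)

/-- For uniformly bounded differences, local `L¹` convergence on a set of full measure implies `L¹`
convergence with respect to a finite measure. -/
lemma TendstoL1LocOn.tendsto_lintegral [SecondCountableTopology X] {ν : Measure X}
    [IsFiniteMeasure ν] {A : Set X} {u : ℕ → X → ℝ} (h : TendstoL1LocOn ν A u f) (hA : ν Aᶜ = 0)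
    {M : ℝ≥0} (hM : ∀ n, ∀ x ∈ A, ‖u n x - f x‖ₑ ≤ M) :
    Tendsto (fun n => ∫⁻ x, ‖u n x - f x‖ₑ ∂ν) atTop (𝓝 0) := by
  choose! r hr hlim using h
  obtain ⟨t, htA, htc, hcov⟩ := TopologicalSpace.countable_cover_nhdsWithin
    (f := fun x => ball x (r x)) (s := A)
    fun x hx => mem_nhdsWithin_of_mem_nhds (ball_mem_nhds x (hr x hx))
  rcases t.eq_empty_or_nonempty with rfl | hne
  · have : A = ∅ := by simpa using hcov
    have hν : ν = 0 := by simpa [this] using hA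
    simp [hν]
  obtain ⟨c, hc⟩ := htc.exists_eq_range hne
  have hcA : ∀ i, c i ∈ A := fun i => htA (hc ▸ mem_range_self i)
  -- Finitely many of the balls cover all but a small part of the measure. Convergence holds on each
  -- of these balls, and the uniform bound `M` controls the rest.
  set S : ℕ → Set X := fun N => ⋃ i ∈ Finset.range N, ball (c i) (r (c i)) with hS
  have hSo : ∀ N, IsOpen (S N) := fun N => isOpen_biUnion fun i _ => isOpen_ball
  have hSmono : Monotone S := fun N N' hN =>
    biUnion_subset_biUnion_left fun i hi => Finset.range_mono hN hi
  have hmeas : Tendsto (fun N => ν (S N)ᶜ) atTop (𝓝 0) := by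
    have := tendsto_measure_iInter_atTop (μ := ν) (s := fun N => (S N)ᶜ)
      (fun N => (hSo N).measurableSet.compl.nullMeasurableSet)
      (fun N N' hN => compl_subset_compl.2 (hSmono hN)) ⟨0, measure_ne_top _ _⟩
    rwa [measure_mono_null (fun x hx hxA => ?_) hA] at this
    obtain ⟨y, hy, hxy⟩ := mem_iUnion₂.1 (hcov hxA)
    obtain ⟨i, rfl⟩ : y ∈ range c := hc ▸ hy
    exact mem_iInter.1 hx (i + 1) (mem_iUnion₂.2 ⟨i, by simp, hxy⟩)
  rw [ENNReal.tendsto_nhds_zero]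
  intro δ hδ
  have hδ2 : 0 < δ / 2 := ENNReal.half_pos hδ.ne'
  have hMm : Tendsto (fun N => (M : ℝ≥0∞) * ν (S N)ᶜ) atTop (𝓝 0) := by
    simpa using ENNReal.Tendsto.const_mul hmeas (Or.inr ENNReal.coe_ne_top)
  obtain ⟨N, hN⟩ := ((ENNReal.tendsto_nhds_zero.1 hMm) _ hδ2).exists
  have hfin : Tendsto (fun n => ∑ i ∈ Finset.range N,
      ∫⁻ x in ball (c i) (r (c i)), ‖u n x - f x‖ₑ ∂ν) atTop (𝓝 0) := by
    simpa using tendsto_finsetSum (Finset.range N) fun i _ => hlim (c i) (hcA i)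
  filter_upwards [(ENNReal.tendsto_nhds_zero.1 hfin) _ hδ2] with n hn
  rw [← lintegral_add_compl _ (hSo N).measurableSet, ← ENNReal.add_halves δ]
  refine add_le_add (le_trans ?_ hn) (le_trans ?_ hN)
  · exact lintegral_biUnion_finset_le _ _ _
  · rw [← setLIntegral_const]
    refine lintegral_mono_ae (ae_restrict_of_ae ?_)
    have : ∀ᵐ x ∂ν, x ∈ A := hA
    filter_upwards [this] with x hx using hM n x hx

/-- Truncation of real numbers to `[0, 1]`. -/
def clamp (t : ℝ) : ℝ := max 0 (min t 1)

lemma lipschitzWith_clamp : LipschitzWith 1 clamp :=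
  (LipschitzWith.id.min_const 1).const_max 0

lemma clamp_mem (t : ℝ) : clamp t ∈ Icc (0 : ℝ) 1 :=
  ⟨le_max_left _ _, max_le zero_le_one (min_le_right _ _)⟩

lemma clamp_of_mem {t : ℝ} (ht : t ∈ Icc (0 : ℝ) 1) : clamp t = t := by
  rw [clamp, min_eq_left ht.2, max_eq_right ht.1]

lemma clamp_of_nonpos {t : ℝ} (ht : t ≤ 0) : clamp t = 0 := by
  rw [clamp, max_eq_left ((min_le_left _ _).trans ht)]

lemma clamp_of_one_le {t : ℝ} (ht : 1 ≤ t) : clamp t = 1 := by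
  rw [clamp, min_eq_right ht, max_eq_right zero_le_one]

lemma enorm_sub_le_of_lipschitzWith_one {φ : ℝ → ℝ} (hφ : LipschitzWith 1 φ) (s t : ℝ) :
    ‖φ s - φ t‖ₑ ≤ ‖s - t‖ₑ := by
  have := hφ s t
  rwa [ENNReal.coe_one, one_mul, edist_eq_enorm_sub, edist_eq_enorm_sub] at this

omit [MetricSpace X] [MeasurableSpace X] [BorelSpace X] in
lemma indicator_one_mem (E : Set X) (x : X) : E.indicator (fun _ => (1 : ℝ)) x ∈ Icc (0 : ℝ) 1 := by
  by_cases hx : x ∈ E <;> simp [hx]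

omit [BorelSpace X] in
lemma TendstoL1LocOn.comp_lipschitz {ν : Measure X} {A : Set X} {u : ℕ → X → ℝ}
    (h : TendstoL1LocOn ν A u f) {φ : ℝ → ℝ} (hφ : LipschitzWith 1 φ) :
    TendstoL1LocOn ν A (fun n x => φ (u n x)) fun x => φ (f x) := by
  intro x hx
  obtain ⟨r, hr, hlim⟩ := h x hx
  exact ⟨r, hr, tendsto_of_tendsto_of_tendsto_of_le_of_le tendsto_const_nhds hlim
    (fun _ => zero_le) fun n => lintegral_mono fun y => enorm_sub_le_of_lipschitzWith_one hφ _ _⟩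

/-- The definition of the perimeter only offers convergence on small balls. Clamping to `[0, 1]`
fixes `χ_E`, does not increase the energy and bounds the differences by 1, so the convergence holds
in `L¹` on every bounded set, because such a set has finite measure. -/
lemma approxBV_of_perimeter_lt_top [SecondCountableTopology X]
    (hμ : ∀ s : Set X, Bornology.IsBounded s → μ s < ∞) {E : Set X}
    (h : perimeter μ univ E < ∞) :
    ApproxBV μ (E.indicator fun _ => (1 : ℝ)) (perimeter μ univ E) := by
  intro B hB δ hδ
  have h1 : perimeter μ univ E < perimeter μ univ E + δ := ENNReal.lt_add_right h.ne hδ.ne'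
  conv_lhs at h1 => rw [perimeter, totalVariation]
  simp only [totalVariationOpen, iInf_lt_iff] at h1
  obtain ⟨A, ⟨-, hA⟩, u, ⟨hu, huE⟩, hlim⟩ := h1
  obtain rfl : A = univ := univ_subset_iff.1 hA
  simp only [Measure.restrict_univ] at hlim huE
  have : IsFiniteMeasure (μ.restrict B) := ⟨by simpa using hμ B hB⟩
  have hconv : TendstoL1LocOn (μ.restrict B) univ (fun n x => clamp (u n x))
      (E.indicator fun _ => (1 : ℝ)) := by
    intro x hx
    obtain ⟨r, hr, hl⟩ := huE.comp_lipschitz lipschitzWith_clamp x hx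
    refine ⟨r, hr, tendsto_of_tendsto_of_tendsto_of_le_of_le tendsto_const_nhds hl
      (fun _ => zero_le) fun n => ?_⟩
    refine (lintegral_mono' (Measure.restrict_mono le_rfl Measure.restrict_le_self) le_rfl).trans
      (lintegral_mono fun y => le_of_eq ?_)
    simp only [clamp_of_mem (indicator_one_mem E y)]
  have hconv' := hconv.tendsto_lintegral (M := 1) (by simp) fun n x _ => by
    have h1 := clamp_mem (u n x)
    have h2 := indicator_one_mem E x
    rw [Real.enorm_eq_ofReal_abs, ENNReal.coe_one, ← ENNReal.ofReal_one]
    refine ENNReal.ofReal_le_ofReal (abs_le.2 ⟨?_, ?_⟩) <;> linarith [h1.1, h1.2, h2.1, h2.2]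
  obtain ⟨n, hn1, hn2⟩ := ((frequently_lt_of_liminf_lt (by isBoundedDefault) hlim).and_eventually
    ((ENNReal.tendsto_nhds_zero.1 hconv') δ hδ)).exists
  have hun : ∀ x, asympLip (u n) x < ∞ :=
    (locallyLipschitz_iff.1 (locallyLipschitzOn_univ.1 (hu n)))
  have hle : ∀ x, asympLip (fun y => clamp (u n y)) x ≤ asympLip (u n) x := fun x =>
    asympLip_comp_le_of_one lipschitzWith_clamp (hun x)
  exact ⟨fun x => clamp (u n x), locallyLipschitz_iff.2 fun x => (hle x).trans_lt (hun x), hn2,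
    (lintegral_mono hle).trans hn1.le⟩

end ApproxBV

/-! ### Lipschitz partitions of unity subordinate to a locally bounded weight. -/

section Partition

variable {X : Type*} [MetricSpace X]

/-- Local boundedness of an extended nonnegative function. -/
def LocallyBoundedFun (h : X → ℝ≥0∞) : Prop :=
  ∀ x, ∃ r : ℝ, 0 < r ∧ ∃ C : ℝ≥0, ∀ y ∈ ball x r, h y ≤ C

lemma exists_lipschitz_partition [Nonempty X] [SecondCountableTopology X] {h : X → ℝ≥0∞}
    (hh : LocallyBoundedFun h) :
    ∃ θ : ℕ → X → ℝ, (∀ n, ∃ K, LipschitzWith K (θ n)) ∧ (∀ n x, 0 ≤ θ n x) ∧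
      (∀ n x, ∑ i ∈ Finset.range n, θ i x ≤ 1) ∧
      (∀ x, ∃ N, ∀ᶠ y in 𝓝 x, (∀ n, N ≤ n → θ n y = 0) ∧ ∑ i ∈ Finset.range N, θ i y = 1) ∧
      ∀ n, ∃ (S : Set X) (C : ℝ≥0), IsClosed S ∧ Bornology.IsBounded S ∧ (∀ y ∈ S, h y ≤ C) ∧
        ∀ y ∉ S, θ n y = 0 := by
  choose r hr C hC using hh
  have hr3 : ∀ x, 0 < r x / 3 := fun x => div_pos (hr x) three_pos
  obtain ⟨t, htc, hcov⟩ := TopologicalSpace.countable_cover_nhds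
    (f := fun x : X => ball x (r x / 3)) fun x => ball_mem_nhds x (hr3 x)
  have hne : t.Nonempty := by
    by_contra hne
    rw [not_nonempty_iff_eq_empty] at hne
    simp only [hne, mem_empty_iff_false, iUnion_of_empty, iUnion_empty] at hcov
    exact empty_ne_univ hcov
  obtain ⟨c, hc⟩ := htc.exists_eq_range hne
  -- A bump that equals 1 on the ball of radius `r / 3` and vanishes outside the closed ball of
  -- radius `2 r / 3`, on which the weight is still bounded.
  set b : ℕ → X → ℝ := fun n y => clamp (2 - (3 / r (c n)) * dist y (c n)) with hb
  have hbL : ∀ n, ∃ K, LipschitzWith K (b n) := by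
    intro n
    have h1 : LipschitzWith ‖3 / r (c n)‖₊ fun t : ℝ => (3 / r (c n)) * t := by
      simpa using lipschitzWith_smul (α := ℝ) (β := ℝ) (3 / r (c n))
    exact ⟨_, lipschitzWith_clamp.comp ((LipschitzWith.const 2).sub
      (h1.comp (LipschitzWith.dist_left (c n))))⟩
  have hb1 : ∀ n, ∀ y ∈ ball (c n) (r (c n) / 3), b n y = 1 := by
    intro n y hy
    refine clamp_of_one_le ?_
    have : 3 / r (c n) * dist y (c n) ≤ 1 := by
      rw [div_mul_eq_mul_div, div_le_one (hr _)]
      linarith [mem_ball.1 hy]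
    linarith
  have hb0 : ∀ n, ∀ y ∉ closedBall (c n) (2 * r (c n) / 3), b n y = 0 := by
    intro n y hy
    refine clamp_of_nonpos ?_
    have : 2 ≤ 3 / r (c n) * dist y (c n) := by
      rw [div_mul_eq_mul_div, le_div_iff₀ (hr _)]
      rw [mem_closedBall, not_le] at hy
      linarith
    linarith
  -- Running maxima of the bumps. Their increments telescope, and they stop as soon as one bump
  -- equals 1, which makes the partition locally finite while each increment is globally Lipschitz.
  set ψ : ℕ → X → ℝ := fun n y => Nat.rec 0 (fun k v => max v (b k y)) n with hψ
  have hψ0 : ∀ y, ψ 0 y = 0 := fun y => rfl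
  have hψs : ∀ n y, ψ (n + 1) y = max (ψ n y) (b n y) := fun n y => rfl
  have hψL : ∀ n, ∃ K, LipschitzWith K (ψ n) := by
    intro n
    induction n with
    | zero => exact ⟨0, LipschitzWith.const 0⟩
    | succ n ih =>
      obtain ⟨K, hK⟩ := ih
      obtain ⟨L, hL⟩ := hbL n
      exact ⟨_, hK.max hL⟩
  have hψnn : ∀ n y, 0 ≤ ψ n y := by
    intro n y
    induction n with
    | zero => exact le_rfl
    | succ n ih => exact ih.trans (le_max_left _ _)
  have hψ1 : ∀ n y, ψ n y ≤ 1 := by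
    intro n y
    induction n with
    | zero => exact zero_le_one
    | succ n ih => exact max_le ih (clamp_mem _).2
  have hsum : ∀ n y, ∑ i ∈ Finset.range n, (ψ (i + 1) y - ψ i y) = ψ n y := by
    intro n y
    rw [Finset.sum_range_sub (fun i => ψ i y), hψ0, sub_zero]
  refine ⟨fun n y => ψ (n + 1) y - ψ n y, fun n => ?_, fun n y => ?_, fun n y => ?_, fun x => ?_,
    fun n => ?_⟩
  · obtain ⟨K, hK⟩ := hψL n
    obtain ⟨L, hL⟩ := hψL (n + 1)
    exact ⟨_, hL.sub hK⟩
  · rw [sub_nonneg, hψs]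
    exact le_max_left _ _
  · rw [hsum]
    exact hψ1 n y
  · obtain ⟨z, hz, hxz⟩ := mem_iUnion₂.1 (hcov.symm ▸ mem_univ x : x ∈ ⋃ x ∈ t, ball x (r x / 3))
    obtain ⟨m, rfl⟩ : z ∈ range c := hc ▸ hz
    refine ⟨m + 1, ?_⟩
    filter_upwards [isOpen_ball.mem_nhds hxz] with y hy
    have hone : ∀ n, m + 1 ≤ n → ψ n y = 1 := by
      intro n hn
      induction n, hn using Nat.le_induction with
      | base => rw [hψs, hb1 m y hy, max_eq_right (hψ1 m y)]
      | succ n hn ih => rw [hψs, ih, max_eq_left (clamp_mem _).2]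
    exact ⟨fun n hn => by rw [hone n hn, hone _ (hn.trans n.le_succ), sub_self],
      by rw [hsum, hone _ le_rfl]⟩
  · refine ⟨closedBall (c n) (2 * r (c n) / 3), C (c n), isClosed_closedBall, isBounded_closedBall,
      fun y hy => hC _ y (closedBall_subset_ball ?_ hy), fun y hy => ?_⟩
    · linarith [hr (c n)]
    · show ψ (n + 1) y - ψ n y = 0
      rw [hψs, hb0 n y hy, max_eq_left (hψnn n y), sub_self]

/-- As the `θ i` sum to 1 near `x`, the constant `c` can be subtracted from each `v i` without
changing the Lipschitz constant of the sum. With `c = g x`, the derivatives of the `θ i` are paired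
with the small quantities `v i - g`. -/
lemma asympLip_tsum_mul_le {θ v : ℕ → X → ℝ} (hθL : ∀ n, ∃ K, LipschitzWith K (θ n))
    (hθ : ∀ n x, 0 ≤ θ n x) (hv : ∀ n, LocallyLipschitz (v n)) {x : X} {N : ℕ}
    (hN : ∀ᶠ y in 𝓝 x, (∀ n, N ≤ n → θ n y = 0) ∧ ∑ i ∈ Finset.range N, θ i y = 1) (c : ℝ) :
    asympLip (fun y => ∑' i, θ i y * v i y) x ≤ ∑ i ∈ Finset.range N,
      (ENNReal.ofReal (θ i x) * asympLip (v i) x + ‖v i x - c‖ₑ * asympLip (θ i) x) := by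
  have hθ' : ∀ i, asympLip (θ i) x < ∞ := fun i =>
    LipschitzWith.asympLip_lt_top (hθL i).choose_spec
  have hvc' : ∀ i, asympLip (fun y => v i y + -c) x ≤ asympLip (v i) x := fun i =>
    asympLip_add_const_le _ ((hv i).asympLip_lt_top x)
  have hvc : ∀ i, asympLip (fun y => v i y + -c) x < ∞ := fun i =>
    (hvc' i).trans_lt ((hv i).asympLip_lt_top x)
  have hmul : ∀ i, asympLip (fun y => θ i y * (v i y + -c)) x ≤
      ENNReal.ofReal (θ i x) * asympLip (v i) x + ‖v i x - c‖ₑ * asympLip (θ i) x := by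
    intro i
    refine (asympLip_mul_le (hθ' i) (hvc i)).trans ?_
    rw [Real.enorm_of_nonneg (hθ i x), ← sub_eq_add_neg]
    gcongr
    exact hvc' i
  have hmul' : ∀ i ∈ Finset.range N, asympLip (fun y => θ i y * (v i y + -c)) x < ∞ := fun i _ =>
    (hmul i).trans_lt (ENNReal.add_lt_top.2
      ⟨ENNReal.mul_lt_top ENNReal.ofReal_lt_top ((hv i).asympLip_lt_top x),
        ENNReal.mul_lt_top enorm_lt_top (hθ' i)⟩)
  have hsum := asympLip_sum_le (Finset.range N) (fun i y => θ i y * (v i y + -c)) hmul'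
  have hcongr : (fun y => ∑' i, θ i y * v i y) =ᶠ[𝓝 x]
      fun y => ∑ i ∈ Finset.range N, θ i y * (v i y + -c) + c := by
    filter_upwards [hN] with y hy
    rw [tsum_eq_sum (s := Finset.range N) fun i hi => by
      rw [hy.1 i (by simpa using hi), zero_mul]]
    simp only [mul_add, Finset.sum_add_distrib, ← Finset.sum_mul, hy.2]
    ring
  rw [asympLip_congr hcongr]
  exact (asympLip_add_const_le c (hsum.trans_lt (ENNReal.sum_lt_top.2 hmul'))).trans
    (hsum.trans (Finset.sum_le_sum fun i _ => hmul i))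

end Partition

/-! ### Approximation in a weighted `L¹` space. -/

section Weighted

variable {X : Type*} [MetricSpace X] [MeasurableSpace X] [BorelSpace X] {μ : Measure X}
  {g : X → ℝ} {P : ℝ≥0∞}

/-- Compactness of `[0, ∞]`. Ultrafilter limits let infinitely many sequences converge at once,
without extracting subsequences. -/
lemma tendsto_ultrafilter_lim (U : Ultrafilter ℕ) (a : ℕ → ℝ≥0∞) :
    Tendsto a U (𝓝 (U.map a).lim) :=
  (U.map a).le_nhds_lim

/-- An approximation of `g` can be chosen close to `g` in a weighted `L¹` space, for every locally
bounded weight. -/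
lemma ApproxBV.exists_weighted [SecondCountableTopology X] (hg : ApproxBV μ g P)
    (hgm : Measurable g) (hP : P ≠ ∞) {h : X → ℝ≥0∞} (hh : LocallyBoundedFun h) {δ : ℝ≥0∞}
    (hδ : 0 < δ) :
    ∃ v : X → ℝ, LocallyLipschitz v ∧ ∫⁻ x, asympLip v x ∂μ ≤ P + δ ∧
      ∫⁻ x, h x * ‖v x - g x‖ₑ ∂μ ≤ δ := by
  rcases isEmpty_or_nonempty X with hX | hX
  · exact ⟨fun _ => 0, fun x => hX.elim x, by simp [Measure.eq_zero_of_isEmpty μ],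
      by simp [Measure.eq_zero_of_isEmpty μ]⟩
  obtain ⟨θ, hθL, hθ, hθ1, hθN, hS⟩ := exists_lipschitz_partition hh
  choose S C hSc hSb hC hS0 using hS
  have hθL' := hθL
  choose K hK using hθL'
  obtain ⟨w, hw, hw1, hw2⟩ := hg.exists_seq (ε := fun n => ((n : ℝ≥0∞) + 1)⁻¹) (by simp)
  have hε0 : Tendsto (fun n : ℕ => ((n : ℝ≥0∞) + 1)⁻¹) atTop (𝓝 0) := by
    have := (tendsto_add_atTop_iff_nat 1).2 ENNReal.tendsto_inv_nat_nhds_zero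
    simpa using this
  have hU : (hyperfilter ℕ : Filter ℕ) ≤ atTop := Nat.hyperfilter_le_atTop
  -- `a i k` is the energy of `w k` seen by `θ i`. Its ultrafilter limits `β i` are additive in `i`,
  -- so their sum is at most `P`, although a different `k` will be used for each `i`.
  set a : ℕ → ℕ → ℝ≥0∞ := fun i k => ∫⁻ x, ENNReal.ofReal (θ i x) * asympLip (w k) x ∂μ with ha
  set β : ℕ → ℝ≥0∞ := fun i => ((hyperfilter ℕ).map (a i)).lim with hβ
  have hβlim : ∀ i, Tendsto (a i) (hyperfilter ℕ) (𝓝 (β i)) := fun i =>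
    tendsto_ultrafilter_lim _ _
  have hθm : ∀ i, Measurable fun x => ENNReal.ofReal (θ i x) := fun i =>
    (hK i).continuous.measurable.ennreal_ofReal
  have hβP : ∑' i, β i ≤ P := by
    refine ENNReal.tsum_le_of_sum_range_le fun n => ?_
    have h1 : Tendsto (fun k => ∑ i ∈ Finset.range n, a i k) (hyperfilter ℕ)
        (𝓝 (∑ i ∈ Finset.range n, β i)) := tendsto_finsetSum _ fun i _ => hβlim i
    have h2 : Tendsto (fun k : ℕ => P + ((k : ℝ≥0∞) + 1)⁻¹) (hyperfilter ℕ) (𝓝 P) := by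
      simpa using (tendsto_const_nhds.add hε0).mono_left hU
    refine le_of_tendsto_of_tendsto' h1 h2 fun k => le_trans ?_ (hw2 k)
    have hm : ∀ i, Measurable fun x => ENNReal.ofReal (θ i x) * asympLip (w k) x := fun i =>
      (hθm i).mul (measurable_asympLip _)
    rw [← lintegral_finsetSum _ fun i _ => hm i]
    refine lintegral_mono fun x => ?_
    rw [← Finset.sum_mul, ← ENNReal.ofReal_sum_of_nonneg fun i _ => hθ i x]
    exact mul_le_of_le_one_left' (ENNReal.ofReal_le_one.2 (hθ1 n x))
  obtain ⟨ε, hε, hεsum⟩ := ENNReal.exists_pos_sum_of_countable' (ENNReal.half_pos hδ.ne').ne' ℕ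
  -- The factor `K i` pays for the derivative of `θ i`, and `C i` for the weight on its support.
  have hk : ∀ i, ∃ k, a i k ≤ β i + ε i ∧
      (K i + C i : ℝ≥0∞) * ∫⁻ x in S i, ‖w k x - g x‖ₑ ∂μ ≤ ε i := by
    intro i
    have hβi : β i ≠ ∞ := ((ENNReal.le_tsum i).trans hβP).trans_lt hP.lt_top |>.ne
    have e1 : ∀ᶠ k in (hyperfilter ℕ : Filter ℕ), a i k ≤ β i + ε i :=
      ((hβlim i).eventually_lt_const (ENNReal.lt_add_right hβi (hε i).ne')).mono fun _ h => h.le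
    have hlim : Tendsto (fun k : ℕ => (K i + C i : ℝ≥0∞) * ((k : ℝ≥0∞) + 1)⁻¹) atTop (𝓝 0) := by
      simpa using ENNReal.Tendsto.const_mul hε0 (Or.inr (by simp))
    have e2 := (ENNReal.tendsto_nhds_zero.1 hlim) _ (hε i)
    obtain ⟨k, hk1, hk2, hk3⟩ := (e1.and (hU (e2.and (hw1 _ (hSb i))))).exists
    exact ⟨k, hk1, le_trans (by gcongr) hk2⟩
  choose k hk1 hk2 using hk
  have hv : ∀ n, LocallyLipschitz (w (k n)) := fun n => hw (k n)
  have hθS : ∀ i x, asympLip (θ i) x ≤ (S i).indicator (fun _ => (K i : ℝ≥0∞)) x := by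
    intro i x
    by_cases hx : x ∈ S i
    · rw [indicator_of_mem hx]
      exact asympLip_le_of_lipschitzWith (hK i)
    · rw [asympLip_eq_zero_of_eventuallyEq (c := 0)]
      · exact zero_le
      · filter_upwards [(hSc i).isOpen_compl.mem_nhds hx] with y hy using hS0 i y hy
  have hterm : ∀ i, ∫⁻ x, ‖w (k i) x - g x‖ₑ * asympLip (θ i) x ∂μ ≤ ε i := by
    intro i
    refine le_trans ?_ (hk2 i)
    calc _ ≤ ∫⁻ x, (S i).indicator (fun x => (K i : ℝ≥0∞) * ‖w (k i) x - g x‖ₑ) x ∂μ := by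
          refine lintegral_mono fun x => ?_
          refine (mul_le_mul_right (hθS i x) _).trans ?_
          by_cases hx : x ∈ S i <;> simp [hx, mul_comm]
      _ = ∫⁻ x in S i, (K i : ℝ≥0∞) * ‖w (k i) x - g x‖ₑ ∂μ :=
          lintegral_indicator (hSc i).measurableSet _
      _ = K i * ∫⁻ x in S i, ‖w (k i) x - g x‖ₑ ∂μ :=
          lintegral_const_mul' _ _ ENNReal.coe_ne_top
      _ ≤ _ := by gcongr; exact le_self_add
  set m : ℕ → X → ℝ≥0∞ := fun i => (S i).indicator fun x => (C i : ℝ≥0∞) * ‖w (k i) x - g x‖ₑ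
    with hm
  have hmint : ∀ i, ∫⁻ x, m i x ∂μ ≤ ε i := by
    intro i
    refine le_trans ?_ (hk2 i)
    rw [lintegral_indicator (hSc i).measurableSet, lintegral_const_mul' _ _ ENNReal.coe_ne_top]
    gcongr
    exact le_add_self
  have hmle : ∀ i x, h x * (ENNReal.ofReal (θ i x) * ‖w (k i) x - g x‖ₑ) ≤ m i x := by
    intro i x
    by_cases hx : x ∈ S i
    · have h1 : θ i x ≤ 1 := (Finset.single_le_sum (fun j _ => hθ j x)
        (Finset.self_mem_range_succ i)).trans (hθ1 (i + 1) x)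
      simp only [hm, indicator_of_mem hx]
      refine mul_le_mul' (hC i x hx) (mul_le_of_le_one_left' (ENNReal.ofReal_le_one.2 h1))
    · simp [hS0 i x hx]
  have hpt : ∀ x, asympLip (fun y => ∑' i, θ i y * w (k i) y) x ≤
      ∑' i, (ENNReal.ofReal (θ i x) * asympLip (w (k i)) x +
        ‖w (k i) x - g x‖ₑ * asympLip (θ i) x) := by
    intro x
    obtain ⟨N, hN⟩ := hθN x
    exact (asympLip_tsum_mul_le (fun n => ⟨_, hK n⟩) hθ hv hN (g x)).trans
      (ENNReal.sum_le_tsum _)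
  refine ⟨fun y => ∑' i, θ i y * w (k i) y, locallyLipschitz_iff.2 fun x => ?_, ?_, ?_⟩
  · obtain ⟨N, hN⟩ := hθN x
    refine (asympLip_tsum_mul_le (fun n => ⟨_, hK n⟩) hθ hv hN (g x)).trans_lt
      (ENNReal.sum_lt_top.2 fun i _ => ENNReal.add_lt_top.2
      ⟨ENNReal.mul_lt_top ENNReal.ofReal_lt_top ((hv i).asympLip_lt_top x),
        ENNReal.mul_lt_top enorm_lt_top (LipschitzWith.asympLip_lt_top (hK i))⟩)
  · refine (lintegral_mono hpt).trans ?_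
    have hm1 : ∀ i, Measurable fun x => ENNReal.ofReal (θ i x) * asympLip (w (k i)) x := fun i =>
      (hθm i).mul (measurable_asympLip _)
    have hm2 : ∀ i, Measurable fun x => ‖w (k i) x - g x‖ₑ * asympLip (θ i) x := fun i =>
      ((hv i).continuous.measurable.sub hgm).enorm.mul (measurable_asympLip _)
    have hm3 : ∀ i, Measurable fun x => ENNReal.ofReal (θ i x) * asympLip (w (k i)) x +
        ‖w (k i) x - g x‖ₑ * asympLip (θ i) x := fun i => (hm1 i).add (hm2 i)
    rw [lintegral_tsum fun i => (hm3 i).aemeasurable]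
    calc _ ≤ ∑' i, (β i + ε i + ε i) := by
          refine ENNReal.tsum_le_tsum fun i => ?_
          rw [lintegral_add_left (hm1 i)]
          exact add_le_add (hk1 i) (hterm i)
      _ = ∑' i, β i + (∑' i, ε i + ∑' i, ε i) := by
          rw [ENNReal.tsum_add, ENNReal.tsum_add, add_assoc]
      _ ≤ P + (δ / 2 + δ / 2) := by gcongr
      _ = P + δ := by rw [ENNReal.add_halves]
  · have hpt2 : ∀ x, h x * ‖(∑' i, θ i x * w (k i) x) - g x‖ₑ ≤ ∑' i, m i x := by
      intro x
      obtain ⟨N, hN⟩ := hθN x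
      obtain ⟨hN0, hN1⟩ := hN.self_of_nhds
      have hsum : (∑' i, θ i x * w (k i) x) - g x =
          ∑ i ∈ Finset.range N, θ i x * (w (k i) x - g x) := by
        rw [tsum_eq_sum (s := Finset.range N) fun i hi => by
          rw [hN0 i (by simpa using hi), zero_mul]]
        simp only [mul_sub, Finset.sum_sub_distrib, ← Finset.sum_mul, hN1, one_mul]
      calc _ ≤ h x * ∑ i ∈ Finset.range N, ENNReal.ofReal (θ i x) * ‖w (k i) x - g x‖ₑ := by
            rw [hsum]
            gcongr
            refine (enorm_sum_le _ _).trans (Finset.sum_le_sum fun i _ => ?_)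
            rw [enorm_mul, Real.enorm_of_nonneg (hθ i x)]
        _ ≤ ∑ i ∈ Finset.range N, m i x := by
            rw [Finset.mul_sum]
            exact Finset.sum_le_sum fun i _ => hmle i x
        _ ≤ _ := ENNReal.sum_le_tsum _
    refine (lintegral_mono hpt2).trans ?_
    have hmm : ∀ i, Measurable (m i) := fun i =>
      (((hv i).continuous.measurable.sub hgm).enorm.const_mul _).indicator (hSc i).measurableSet
    rw [lintegral_tsum fun i => (hmm i).aemeasurable]
    exact (ENNReal.tsum_le_tsum hmint).trans (hεsum.le.trans ENNReal.half_le_self)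

end Weighted

/-! ### The coarea inequality. -/

section Coarea

variable {X : Type*} [MetricSpace X]

/-- The piecewise linear function that vanishes on `(-∞, s - h]` and equals `1` on `[s + h, ∞)`. -/
noncomputable def ramp (h s t : ℝ) : ℝ := clamp ((2 * h)⁻¹ * (t - s) + 1 / 2)

lemma ramp_eq_one {h s t : ℝ} (hh : 0 < h) (ht : s + h ≤ t) : ramp h s t = 1 := by
  refine clamp_of_one_le ?_
  have : 1 / 2 ≤ (2 * h)⁻¹ * (t - s) := by
    rw [inv_mul_eq_div, le_div_iff₀ (by positivity)]
    linarith
  linarith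

lemma ramp_eq_zero {h s t : ℝ} (hh : 0 < h) (ht : t ≤ s - h) : ramp h s t = 0 := by
  refine clamp_of_nonpos ?_
  have : (2 * h)⁻¹ * (t - s) ≤ -(1 / 2) := by
    rw [inv_mul_eq_div, div_le_iff₀ (by positivity)]
    linarith
  linarith

lemma lipschitzWith_ramp (h s : ℝ) : LipschitzWith ‖(2 * h)⁻¹‖₊ (ramp h s) := by
  have h1 : LipschitzWith ‖(2 * h)⁻¹‖₊ fun t : ℝ => (2 * h)⁻¹ * (t - s) + 1 / 2 := by
    refine LipschitzWith.of_dist_le_mul fun x y => le_of_eq ?_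
    rw [Real.dist_eq, Real.dist_eq, show (2 * h)⁻¹ * (x - s) + 1 / 2 -
      ((2 * h)⁻¹ * (y - s) + 1 / 2) = (2 * h)⁻¹ * (x - y) by ring, abs_mul]
    simp
  have := lipschitzWith_clamp.comp h1
  rwa [one_mul] at this

/-- Off the closed ball, `w x` lies strictly inside a region where the ramp is constant, and by
continuity so do nearby values of `w`. -/
lemma asympLip_ramp_le {w : X → ℝ} {x : X} {h s : ℝ} (hh : 0 < h) (hw : asympLip w x < ∞) :
    asympLip (fun y => ramp h s (w y)) x ≤
      (closedBall (w x) h).indicator (fun _ => ‖(2 * h)⁻¹‖ₑ) s * asympLip w x := by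
  by_cases hs : s ∈ closedBall (w x) h
  · rw [indicator_of_mem hs]
    exact asympLip_comp_le (lipschitzWith_ramp h s) hw
  · rw [mem_closedBall, Real.dist_eq, not_le, lt_abs] at hs
    have hc := continuousAt_of_asympLip hw
    rcases hs with hs | hs
    · rw [asympLip_eq_zero_of_eventuallyEq (c := 0)]
      · exact zero_le
      · filter_upwards [hc.eventually_lt_const (show w x < s - h by linarith)] with y hy
        exact ramp_eq_zero hh hy.le
    · rw [asympLip_eq_zero_of_eventuallyEq (c := 1)]
      · exact zero_le
      · filter_upwards [hc.eventually_const_lt (show s + h < w x by linarith)] with y hy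
        exact ramp_eq_one hh hy.le

lemma tendsto_ramp {h : ℕ → ℝ} (hh : ∀ n, 0 < h n) (hh0 : Tendsto h atTop (𝓝 0)) {u : ℕ → ℝ}
    {a s : ℝ} (hu : Tendsto u atTop (𝓝 a)) (has : a ≠ s) :
    Tendsto (fun n => ramp (h n) s (u n)) atTop (𝓝 (if s ≤ a then 1 else 0)) := by
  have h1 : Tendsto (fun n => u n - h n) atTop (𝓝 a) := by simpa using hu.sub hh0
  have h2 : Tendsto (fun n => u n + h n) atTop (𝓝 a) := by simpa using hu.add hh0
  refine tendsto_const_nhds.congr' ?_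
  rcases lt_or_gt_of_ne has with hlt | hlt
  · rw [if_neg hlt.not_ge]
    filter_upwards [h2.eventually_lt_const hlt] with n hn
    exact (ramp_eq_zero (hh n) (by linarith)).symm
  · rw [if_pos hlt.le]
    filter_upwards [h1.eventually_const_lt hlt] with n hn
    exact (ramp_eq_one (hh n) (by linarith)).symm

variable [MeasurableSpace X] [BorelSpace X] {μ : Measure X} {g : X → ℝ} {C : ℝ≥0∞}

omit [BorelSpace X] in
lemma sigmaFinite_of_bounded [SecondCountableTopology X]
    (hμ : ∀ s : Set X, Bornology.IsBounded s → μ s < ∞) : SigmaFinite μ := by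
  have : IsLocallyFiniteMeasure μ :=
    ⟨fun x => ⟨ball x 1, ball_mem_nhds x one_pos, hμ _ isBounded_ball⟩⟩
  infer_instance

omit [BorelSpace X] in
-- The errors are summable on each ball of integer radius, and these balls exhaust the space.
lemma ae_tendsto_of_lintegral_le {w : ℕ → X → ℝ} (hw : ∀ n, Measurable (w n)) (hg : Measurable g)
    (h : ∀ B : Set X, Bornology.IsBounded B →
      ∀ᶠ n in atTop, ∫⁻ x in B, ‖w n x - g x‖ₑ ∂μ ≤ 2⁻¹ ^ n) :
    ∀ᵐ x ∂μ, Tendsto (fun n => w n x) atTop (𝓝 (g x)) := by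
  rcases isEmpty_or_nonempty X with hX | ⟨⟨x₀⟩⟩
  · simp [Measure.eq_zero_of_isEmpty μ]
  rw [← Measure.restrict_univ (μ := μ), ← iUnion_ball_nat x₀, ae_restrict_iUnion_iff]
  intro R
  obtain ⟨N, hN⟩ := eventually_atTop.1 (h (ball x₀ R) isBounded_ball)
  have hm : ∀ n, Measurable fun x => ‖w (n + N) x - g x‖ₑ := fun n => ((hw _).sub hg).enorm
  have hfin : ∫⁻ x in ball x₀ R, ∑' n, ‖w (n + N) x - g x‖ₑ ∂μ ≠ ∞ := by
    rw [lintegral_tsum fun n => (hm n).aemeasurable]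
    refine ne_top_of_le_ne_top ?_ (ENNReal.tsum_le_tsum (g := fun n => 2⁻¹ ^ n) fun n => ?_)
    · rw [ENNReal.tsum_geometric]
      simp
    · exact (hN (n + N) le_add_self).trans
        (pow_le_pow_right_of_le_one' (by simp) le_self_add)
  filter_upwards [ae_lt_top (Measurable.tsum hm) hfin] with x hx
  have := ENNReal.tendsto_atTop_zero_of_tsum_ne_top hx.ne
  rw [← tendsto_add_atTop_iff_nat N, tendsto_iff_edist_tendsto_0]
  simpa only [edist_eq_enorm_sub] using this

/-- A form of the coarea inequality: the perimeters of the superlevel sets of `g` have a measurable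
majorant whose integral is at most the total variation of `g`. -/
lemma ApproxBV.exists_levelSet_bound [SecondCountableTopology X]
    (hμ : ∀ s : Set X, Bornology.IsBounded s → μ s < ∞) (hg : ApproxBV μ g C)
    (hgm : Measurable g) :
    ∃ p : ℝ → ℝ≥0∞, Measurable p ∧ (∀ᵐ s, perimeter μ univ {x | s ≤ g x} ≤ p s) ∧
      ∫⁻ s, p s ≤ C := by
  have := sigmaFinite_of_bounded hμ
  obtain ⟨w, hw, hw1, hw2⟩ := hg.exists_seq (ε := fun n => 2⁻¹ ^ n)
    (fun n => ENNReal.pow_pos (by simp) n)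
  have hwm : ∀ n, Measurable (w n) := fun n => (hw n).continuous.measurable
  have hae := ae_tendsto_of_lintegral_le hwm hgm hw1
  set h : ℕ → ℝ := fun n => 1 / ((n : ℝ) + 1) with hh
  have hpos : ∀ n, 0 < h n := fun n => by positivity
  have hh0 : Tendsto h atTop (𝓝 0) := tendsto_one_div_add_atTop_nhds_zero_nat
  set k : ℕ → ℝ → X → ℝ≥0∞ := fun n s x =>
    (closedBall (w n x) (h n)).indicator (fun _ => ‖(2 * h n)⁻¹‖ₑ) s * asympLip (w n) x with hk
  have hkm : ∀ n, Measurable (Function.uncurry (k n)) := by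
    intro n
    refine Measurable.mul ?_ ((measurable_asympLip _).comp measurable_snd)
    have hset : MeasurableSet {z : ℝ × X | dist z.1 (w n z.2) ≤ h n} :=
      measurableSet_le (measurable_fst.dist ((hwm n).comp measurable_snd)) measurable_const
    exact (measurable_const.indicator hset : Measurable
      ({z : ℝ × X | dist z.1 (w n z.2) ≤ h n}.indicator fun _ => ‖(2 * h n)⁻¹‖ₑ))
  -- By Tonelli: for fixed `x` the levels `s` that contribute fill an interval of length `2 h n`,
  -- which cancels the slope `(2 h n)⁻¹`.
  have hkint : ∀ n, ∫⁻ s, ∫⁻ x, k n s x ∂μ = ∫⁻ x, asympLip (w n) x ∂μ := by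
    intro n
    rw [lintegral_lintegral_swap (hkm n).aemeasurable]
    refine lintegral_congr fun x => ?_
    rw [lintegral_mul_const _ (measurable_const.indicator isClosed_closedBall.measurableSet),
      lintegral_indicator isClosed_closedBall.measurableSet, setLIntegral_const,
      Real.volume_closedBall, Real.enorm_of_nonneg (by have := hpos n; positivity),
      ← ENNReal.ofReal_mul (by have := hpos n; positivity),
      inv_mul_cancel₀ (by have := hpos n; positivity), ENNReal.ofReal_one, one_mul]
  -- The liminf is measurable in `s`, so no measurability of the perimeters is needed, and Fatou's
  -- lemma bounds its integral.
  refine ⟨fun s => liminf (fun n => ∫⁻ x, k n s x ∂μ) atTop,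
    Measurable.liminf fun n => (hkm n).lintegral_prod_right', ?_, ?_⟩
  · have hlev : ∀ᵐ s : ℝ, μ {x | g x = s} = 0 := by
      have := (Measure.countable_meas_level_set_pos (μ := μ) hgm).ae_notMem volume
      filter_upwards [this] with s hs
      simpa using hs
    filter_upwards [hlev] with s hs
    have hlip : ∀ n x, asympLip (fun y => ramp (h n) s (w n y)) x ≤ k n s x := fun n x =>
      asympLip_ramp_le (hpos n) ((hw n).asympLip_lt_top x)
    have hrl : ∀ n, LocallyLipschitz fun y => ramp (h n) s (w n y) := fun n =>
      (lipschitzWith_ramp _ _).locallyLipschitz.comp (hw n)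
    refine (iInf₂_le univ ⟨isOpen_univ, Subset.rfl⟩).trans ?_
    refine (iInf₂_le (fun n y => ramp (h n) s (w n y))
      ⟨fun n => (hrl n).locallyLipschitzOn, fun x _ => ⟨1, one_pos, ?_⟩⟩).trans ?_
    · simp only [Measure.restrict_univ]
      exact liminf_le_liminf (Eventually.of_forall fun n => lintegral_mono (hlip n))
    rw [Measure.restrict_univ]
    have hE : MeasurableSet {x | s ≤ g x} := measurableSet_le measurable_const hgm
    have hlim := tendsto_lintegral_of_dominated_convergence (μ := μ.restrict (ball x 1))
      (F := fun n y => ‖ramp (h n) s (w n y) - {x | s ≤ g x}.indicator (fun _ => (1 : ℝ)) y‖ₑ)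
      (f := fun _ => 0) (fun _ => 1)
      (fun n => ((hrl n).continuous.measurable.sub (measurable_const.indicator hE)).enorm)
      (fun n => Eventually.of_forall fun y => ?_) ?_ ?_
    · simpa using hlim
    · have h1 := clamp_mem ((2 * h n)⁻¹ * (w n y - s) + 1 / 2)
      have h2 := indicator_one_mem {x | s ≤ g x} y
      change ‖clamp _ - _‖ₑ ≤ 1
      rw [Real.enorm_eq_ofReal_abs, ← ENNReal.ofReal_one]
      refine ENNReal.ofReal_le_ofReal (abs_le.2 ⟨?_, ?_⟩) <;> linarith [h1.1, h1.2, h2.1, h2.2]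
    · simpa using (hμ _ isBounded_ball).ne
    · have hs' : ∀ᵐ y ∂μ, g y ≠ s := by rw [ae_iff]; simpa using hs
      filter_upwards [ae_restrict_of_ae hae, ae_restrict_of_ae hs'] with y hy hys
      have := (tendsto_ramp hpos hh0 hy hys).sub_const
        ({x | s ≤ g x}.indicator (fun _ => (1 : ℝ)) y)
      have h0 : (if s ≤ g y then (1 : ℝ) else 0) - {x | s ≤ g x}.indicator (fun _ => (1 : ℝ)) y = 0 := by
        simp [indicator_apply]
      rw [h0] at this
      simpa using this.enorm
  · have hC : Tendsto (fun n : ℕ => C + (2⁻¹ : ℝ≥0∞) ^ n) atTop (𝓝 C) := by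
      simpa using tendsto_const_nhds.add
        (ENNReal.tendsto_pow_atTop_nhds_zero_of_lt_one (r := 2⁻¹) (by simp))
    calc _ ≤ liminf (fun n => ∫⁻ s, ∫⁻ x, k n s x ∂μ) atTop :=
          lintegral_liminf_le fun n => (hkm n).lintegral_prod_right'
      _ ≤ liminf (fun n : ℕ => C + (2⁻¹ : ℝ≥0∞) ^ n) atTop :=
          liminf_le_liminf (Eventually.of_forall fun n => by rw [hkint]; exact hw2 n)
      _ = C := hC.liminf_eq

end Coarea

/-! ### Existence of minimal elements, and what minimality says about closed subsets. -/

section Minimal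

variable {X : Type*} [MetricSpace X] [MeasurableSpace X] [BorelSpace X] {μ : Measure X}
  {Ω : Set X} {lam : ℝ≥0} {C : ℝ≥0∞}

omit [MetricSpace X] [BorelSpace X] in
lemma measure_sdiff_le_add (A B D : Set X) : μ (A \ D) ≤ μ (A \ B) + μ (B \ D) :=
  (measure_mono fun x hx => by
    by_cases hxB : x ∈ B
    · exact Or.inr ⟨hxB, hx.2⟩
    · exact Or.inl ⟨hx.1, hxB⟩).trans (measure_union_le _ _)

omit [MetricSpace X] [BorelSpace X] in
lemma lintegral_enorm_indicator_sub_le {E F : Set X} (hE : MeasurableSet E) (hF : MeasurableSet F)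
    (ν : Measure X) :
    ∫⁻ x, ‖E.indicator (fun _ => (1 : ℝ)) x - F.indicator (fun _ => (1 : ℝ)) x‖ₑ ∂ν ≤
      ν (E \ F) + ν (F \ E) := by
  have h : ∀ x, ‖E.indicator (fun _ => (1 : ℝ)) x - F.indicator (fun _ => (1 : ℝ)) x‖ₑ ≤
      ((E \ F) ∪ (F \ E)).indicator (fun _ => (1 : ℝ≥0∞)) x := by
    intro x
    by_cases h1 : x ∈ E <;> by_cases h2 : x ∈ F <;> simp [h1, h2]
  refine (lintegral_mono h).trans ?_
  rw [lintegral_indicator_const ((hE.diff hF).union (hF.diff hE)), one_mul]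
  exact measure_union_le _ _

/-- Lower semicontinuity of the perimeter. -/
lemma perimeter_le_of_tendsto [SecondCountableTopology X]
    (hμ : ∀ s : Set X, Bornology.IsBounded s → μ s < ∞) {E : Set X} {F : ℕ → Set X}
    (hE : MeasurableSet E) (hF : ∀ n, MeasurableSet (F n))
    (h : Tendsto (fun n => μ (F n \ E) + μ (E \ F n)) atTop (𝓝 0))
    (hC : ∀ᶠ n in atTop, perimeter μ univ (F n) ≤ C) : perimeter μ univ E ≤ C := by
  rcases eq_or_ne C ∞ with rfl | hCt
  · exact le_top
  refine ApproxBV.totalVariation_le (ApproxBV.of_forall_exists fun B _ δ hδ => ?_)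
  obtain ⟨n, hn1, hn2⟩ := (hC.and ((ENNReal.tendsto_nhds_zero.1 h) δ hδ)).exists
  refine ⟨(F n).indicator fun _ => 1, (measurable_const.indicator (hF n)).aemeasurable, ?_,
    (approxBV_of_perimeter_lt_top hμ (hn1.trans_lt hCt.lt_top)).mono (hn1.trans le_self_add)⟩
  exact (setLIntegral_le_lintegral B _).trans
    ((lintegral_enorm_indicator_sub_le (hF n) hE μ).trans hn2)

omit [BorelSpace X] in
lemma Prec.trans {A B D : Set X} (h : Prec μ Ω lam A B) (h' : Prec μ Ω lam B D) :
    Prec μ Ω lam A D := by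
  refine ⟨measure_mono_null (fun x hx => ?_) (measure_union_null h.1 h'.1), h.2.trans h'.2⟩
  by_cases hxB : x ∈ B
  · exact Or.inr ⟨hxB, hx.2⟩
  · exact Or.inl ⟨hx.1, hxB⟩

omit [BorelSpace X] in
lemma Prec.refl (A : Set X) : Prec μ Ω lam A A := ⟨by simp, le_rfl⟩

omit [BorelSpace X] in
-- The greedy step for the construction of a minimal element: a predecessor of almost least measure.
lemma exists_prec_measure_le {A : Set X} (hA : A ∈ competitors μ Ω lam) (hΩ : μ Ω ≠ ∞)
    {ε : ℝ≥0∞} (hε : 0 < ε) :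
    ∃ B ∈ competitors μ Ω lam, Prec μ Ω lam B A ∧
      ∀ D ∈ competitors μ Ω lam, Prec μ Ω lam D A → μ B ≤ μ D + ε := by
  set I : ℝ≥0∞ := ⨅ (D : Set X) (_ : D ∈ competitors μ Ω lam ∧ Prec μ Ω lam D A), μ D with hI
  have hIA : I ≤ μ A := iInf₂_le A ⟨hA, Prec.refl A⟩
  have hIt : I ≠ ∞ := ne_top_of_le_ne_top hΩ (hIA.trans (measure_mono hA.2.1))
  have hlt : I < I + ε := ENNReal.lt_add_right hIt hε.ne'
  simp only [hI, iInf_lt_iff] at hlt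
  obtain ⟨B, ⟨hB, hBA⟩, hlt⟩ := hlt
  refine ⟨B, hB, hBA, fun D hD hDA => hlt.le.trans ?_⟩
  gcongr
  exact iInf₂_le D ⟨hD, hDA⟩

lemma perimeterFunctional_le_of_null [SecondCountableTopology X]
    (hμ : ∀ s : Set X, Bornology.IsBounded s → μ s < ∞) {A B : Set X} (hA : MeasurableSet A)
    (hB : MeasurableSet B) (h1 : μ (A \ B) = 0) (h2 : μ (B \ A) = 0) :
    perimeterFunctional μ Ω lam A ≤ perimeterFunctional μ Ω lam B := by
  have hper : perimeter μ univ A ≤ perimeter μ univ B :=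
    perimeter_le_of_tendsto hμ hA (F := fun _ => B) (fun _ => hB) (by simp [h1, h2])
      (Eventually.of_forall fun _ => le_rfl)
  have hm : μ (Ω \ A) ≤ μ (Ω \ B) + μ (B \ A) := measure_sdiff_le_add _ _ _
  rw [h2, add_zero] at hm
  unfold perimeterFunctional
  gcongr

omit [MetricSpace X] [BorelSpace X] in
-- The sets decrease only up to null sets, so continuity from above is applied to the finite
-- intersections `H n`, which differ from `A n` by null sets.
lemma tendsto_measure_diff_iInter {A : ℕ → Set X} (hA : ∀ n, MeasurableSet (A n))
    (h0 : μ (A 0) ≠ ∞) (hnull : ∀ i n, i ≤ n → μ (A n \ A i) = 0) :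
    Tendsto (fun n => μ (A n \ ⋂ i, A i)) atTop (𝓝 0) := by
  set H : ℕ → Set X := fun n => ⋂ i ∈ Iic n, A i with hH
  have hHm : ∀ n, MeasurableSet (H n) := fun n =>
    MeasurableSet.biInter (to_countable _) fun i _ => hA i
  have hG : MeasurableSet (⋂ i, A i) := MeasurableSet.iInter hA
  have hlim := tendsto_measure_iInter_atTop (μ := μ) (s := fun n => H n \ ⋂ i, A i)
    (fun n => ((hHm n).diff hG).nullMeasurableSet)
    (fun n m hnm => sdiff_subset_sdiff_left (biInter_subset_biInter_left (Iic_subset_Iic.2 hnm)))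
    ⟨0, ne_top_of_le_ne_top h0 (measure_mono (sdiff_subset.trans
      (biInter_subset_of_mem (mem_Iic.2 (le_refl 0)))))⟩
  have hempty : ⋂ n, (H n \ ⋂ i, A i) = ∅ := by
    refine eq_empty_of_forall_notMem fun x hx => ?_
    rw [mem_iInter] at hx
    exact (hx 0).2 (mem_iInter.2 fun i => mem_iInter₂.1 (hx i).1 i (mem_Iic.2 le_rfl))
  rw [hempty, measure_empty] at hlim
  refine tendsto_of_tendsto_of_tendsto_of_le_of_le tendsto_const_nhds hlim (fun _ => zero_le)
    fun n => ?_
  have h1 : μ (A n \ H n) = 0 := by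
    have : A n \ H n ⊆ ⋃ i ∈ Iic n, A n \ A i := by
      intro x hx
      have hxH := hx.2
      simp only [hH, mem_iInter, not_forall] at hxH
      obtain ⟨i, hi, hxi⟩ := hxH
      exact mem_iUnion₂.2 ⟨i, hi, hx.1, hxi⟩
    exact measure_mono_null this
      ((measure_biUnion_null_iff (to_countable _)).2 fun i hi => hnull i n hi)
  have h2 : μ (A n \ ⋂ i, A i) ≤ μ (A n \ H n) + μ (H n \ ⋂ i, A i) := measure_sdiff_le_add _ _ _
  rwa [h1, zero_add] at h2

/-- Below every competitor there is a minimal one. -/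
lemma exists_isMinimalElement [SecondCountableTopology X]
    (hμ : ∀ s : Set X, Bornology.IsBounded s → μ s < ∞) (hΩb : Bornology.IsBounded Ω)
    {A₀ : Set X} (hA₀ : A₀ ∈ competitors μ Ω lam) :
    ∃ G, IsMinimalElement μ Ω lam G ∧
      perimeterFunctional μ Ω lam G ≤ perimeterFunctional μ Ω lam A₀ := by
  have hΩt : μ Ω ≠ ∞ := (hμ Ω hΩb).ne
  have hε : ∀ n : ℕ, 0 < ((n : ℝ≥0∞) + 1)⁻¹ := by simp
  have hε0 : Tendsto (fun n : ℕ => ((n : ℝ≥0∞) + 1)⁻¹) atTop (𝓝 0) := by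
    have := (tendsto_add_atTop_iff_nat 1).2 ENNReal.tendsto_inv_nat_nhds_zero
    simpa using this
  choose step hstep1 hstep2 hstep3 using fun (n : ℕ) (A : competitors μ Ω lam) =>
    exists_prec_measure_le A.2 hΩt (hε n)
  set S : ℕ → competitors μ Ω lam :=
    fun n => Nat.rec ⟨A₀, hA₀⟩ (fun k A => ⟨step k A, hstep1 k A⟩) n with hS
  set A : ℕ → Set X := fun n => S n with hAdef
  have hA : ∀ n, A n ∈ competitors μ Ω lam := fun n => (S n).2
  have hA0 : A 0 = A₀ := rfl
  have hsucc : ∀ n, Prec μ Ω lam (A (n + 1)) (A n) := fun n => hstep2 n (S n)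
  have hopt : ∀ n, ∀ D ∈ competitors μ Ω lam, Prec μ Ω lam D (A n) →
      μ (A (n + 1)) ≤ μ D + ((n : ℝ≥0∞) + 1)⁻¹ := fun n => hstep3 n (S n)
  have hprec : ∀ i n, i ≤ n → Prec μ Ω lam (A n) (A i) := by
    intro i n hin
    induction n, hin using Nat.le_induction with
    | base => exact Prec.refl _
    | succ n hn ih => exact (hsucc n).trans ih
  have hAm : ∀ n, MeasurableSet (A n) := fun n => (hA n).1.measurableSet
  set G : Set X := ⋂ n, A n with hG
  have hGc : IsClosed G := isClosed_iInter fun n => (hA n).1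
  have hGA : ∀ n, G ⊆ A n := fun n => iInter_subset _ n
  have hGΩ : G ⊆ Ω := (hGA 0).trans (hA 0).2.1
  have hdiff : Tendsto (fun n => μ (A n \ G)) atTop (𝓝 0) :=
    tendsto_measure_diff_iInter hAm (ne_top_of_le_ne_top hΩt (measure_mono (hA 0).2.1))
      fun i n hin => (hprec i n hin).1
  have hGM : ∀ n, perimeterFunctional μ Ω lam G ≤ perimeterFunctional μ Ω lam (A n) := by
    intro n
    have hanti : ∀ j i, j ≤ i → μ (Ω \ A j) ≤ μ (Ω \ A i) := by
      intro j i hji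
      have : μ (Ω \ A j) ≤ μ (Ω \ A i) + μ (A i \ A j) := measure_sdiff_le_add _ _ _
      rwa [(hprec j i hji).1, add_zero] at this
    -- The volume term is frozen at index `j`, which turns the bounds on `M_λ(A i)` into a uniform
    -- bound on `Per(A i)`. Lower semicontinuity passes it to `G`, and only then does `j` tend to
    -- infinity.
    have hj : ∀ j, perimeter μ univ G + lam * μ (Ω \ A j) ≤ perimeterFunctional μ Ω lam (A n) := by
      intro j
      have hle : ∀ i, max j n ≤ i → perimeter μ univ (A i) + lam * μ (Ω \ A j) ≤
          perimeterFunctional μ Ω lam (A n) := by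
        intro i hi
        refine le_trans ?_ (hprec n i ((le_max_right _ _).trans hi)).2
        unfold perimeterFunctional
        refine add_le_add_right (mul_le_mul_right ?_ _) _
        exact hanti j i ((le_max_left _ _).trans hi)
      have hfin : (lam : ℝ≥0∞) * μ (Ω \ A j) ≠ ∞ := ENNReal.mul_ne_top ENNReal.coe_ne_top
        (ne_top_of_le_ne_top hΩt (measure_mono sdiff_subset))
      have hper : perimeter μ univ G ≤
          perimeterFunctional μ Ω lam (A n) - lam * μ (Ω \ A j) := by
        refine perimeter_le_of_tendsto hμ hGc.measurableSet hAm ?_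
          ((eventually_ge_atTop (max j n)).mono fun i hi => ?_)
        · have : ∀ i, G \ A i = ∅ := fun i => sdiff_eq_empty.2 (hGA i)
          simpa [this] using hdiff
        · exact ENNReal.le_sub_of_add_le_right hfin (hle i hi)
      calc _ ≤ perimeterFunctional μ Ω lam (A n) - lam * μ (Ω \ A j) + lam * μ (Ω \ A j) := by
            gcongr
        _ = _ := tsub_add_cancel_of_le (le_add_self.trans (hle _ le_rfl))
    have hj' : ∀ j, perimeterFunctional μ Ω lam G ≤
        perimeterFunctional μ Ω lam (A n) + lam * μ (A j \ G) := by
      intro j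
      have hm : μ (Ω \ G) ≤ μ (Ω \ A j) + μ (A j \ G) := measure_sdiff_le_add _ _ _
      calc perimeterFunctional μ Ω lam G
          ≤ perimeter μ univ G + lam * (μ (Ω \ A j) + μ (A j \ G)) := by
            unfold perimeterFunctional
            gcongr
        _ = perimeter μ univ G + lam * μ (Ω \ A j) + lam * μ (A j \ G) := by ring
        _ ≤ _ := by gcongr; exact hj j
    have hlim : Tendsto (fun j => perimeterFunctional μ Ω lam (A n) + lam * μ (A j \ G)) atTop
        (𝓝 (perimeterFunctional μ Ω lam (A n))) := by
      simpa using tendsto_const_nhds.add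
        (ENNReal.Tendsto.const_mul hdiff (Or.inr (ENNReal.coe_ne_top (r := lam))))
    exact ge_of_tendsto' hlim hj'
  have hGcomp : G ∈ competitors μ Ω lam := ⟨hGc, hGΩ, (hGM 0).trans_lt (hA 0).2.2⟩
  refine ⟨G, ⟨hGcomp, fun D hD hDG => ?_⟩, hGM 0⟩
  have hGprec : ∀ n, Prec μ Ω lam G (A n) := fun n => ⟨by rw [sdiff_eq_empty.2 (hGA n)]; simp, hGM n⟩
  -- A predecessor `D` of `G` competed at every greedy step, so it cannot have smaller measure. As
  -- `D` is almost contained in `G`, the two agree up to null sets.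
  have hGD : μ G ≤ μ D := by
    have hlim : Tendsto (fun n : ℕ => μ D + ((n : ℝ≥0∞) + 1)⁻¹) atTop (𝓝 (μ D)) := by
      simpa using tendsto_const_nhds.add hε0
    exact ge_of_tendsto' hlim fun n =>
      (measure_mono (hGA (n + 1))).trans (hopt n D hD (hDG.trans (hGprec n)))
  have hDm : MeasurableSet D := hD.1.measurableSet
  have hnull : μ (G \ D) = 0 := by
    have h1 := measure_inter_add_sdiff G hDm (μ := μ)
    have h2 := measure_inter_add_sdiff D hGc.measurableSet (μ := μ)
    rw [hDG.1, add_zero, inter_comm] at h2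
    have hfin : μ (G ∩ D) ≠ ∞ :=
      ne_top_of_le_ne_top hΩt (measure_mono (inter_subset_left.trans hGΩ))
    rw [← h1, ← h2] at hGD
    have : μ (G ∩ D) + μ (G \ D) ≤ μ (G ∩ D) + 0 := by simpa using hGD
    exact le_antisymm ((ENNReal.add_le_add_iff_left hfin).1 this) zero_le
  exact ⟨hnull, perimeterFunctional_le_of_null hμ hGc.measurableSet hDm hnull hDG.1⟩

omit [MeasurableSpace X] [BorelSpace X] in
-- The distance to the complement; the case `Ω = X` is separate because `infDist` to the empty set
-- is 0.
lemma exists_lipschitzWith_pos_on (hΩ : IsOpen Ω) :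
    ∃ g : X → ℝ, LipschitzWith 1 g ∧ (∀ x ∈ Ω, 0 < g x) ∧ ∀ x ∉ Ω, g x = 0 := by
  rcases (Ωᶜ).eq_empty_or_nonempty with hne | hne
  · rw [compl_empty_iff] at hne
    exact ⟨fun _ => 1, (LipschitzWith.const _).weaken zero_le_one, fun _ _ => one_pos,
      fun x hx => absurd (hne ▸ mem_univ x) hx⟩
  · refine ⟨fun x => infDist x Ωᶜ, lipschitz_infDist_pt _, fun x hx => ?_,
      fun x hx => infDist_zero_of_mem hx⟩
    exact (hΩ.isClosed_compl.notMem_iff_infDist_pos hne).1 fun h => h hx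

/-- An open bounded set can be exhausted in measure by closed subsets of finite perimeter. -/
lemma exists_closed_perimeter_lt_top [SecondCountableTopology X]
    (hμ : ∀ s : Set X, Bornology.IsBounded s → μ s < ∞) (hΩ : IsOpen Ω)
    (hΩb : Bornology.IsBounded Ω) {ε : ℝ≥0∞} (hε : 0 < ε) :
    ∃ A ⊆ Ω, IsClosed A ∧ perimeter μ univ A < ∞ ∧ μ (Ω \ A) < ε := by
  obtain ⟨g, hgL, hgpos, hg0⟩ := exists_lipschitzWith_pos_on hΩ
  have hgm : Measurable g := hgL.continuous.measurable
  -- `g` approximates itself: `lip_a(g)` is at most 1 and vanishes off `closure Ω`, which is bounded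
  -- and so of finite measure.
  have hA : ApproxBV μ g (μ (closure Ω)) := by
    intro B _ δ _
    refine ⟨g, hgL.locallyLipschitz, by simp, ?_⟩
    have : ∀ x, asympLip g x ≤ (closure Ω).indicator (fun _ => (1 : ℝ≥0∞)) x := by
      intro x
      by_cases hx : x ∈ closure Ω
      · rw [indicator_of_mem hx]
        exact_mod_cast asympLip_le_of_lipschitzWith hgL
      · rw [asympLip_eq_zero_of_eventuallyEq (c := 0)]
        · exact zero_le
        · filter_upwards [isClosed_closure.isOpen_compl.mem_nhds hx] with y hy
          exact hg0 y fun hyΩ => hy (subset_closure hyΩ)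
    refine (lintegral_mono this).trans ?_
    rw [lintegral_indicator_const isClosed_closure.measurableSet, one_mul]
    exact le_self_add
  obtain ⟨p, hpm, hp, hpint⟩ := hA.exists_levelSet_bound hμ hgm
  have hpfin : ∀ᵐ s, p s < ∞ := ae_lt_top hpm (hpint.trans_lt (hμ _ hΩb.closure)).ne
  have hlim : Tendsto (fun n : ℕ => μ (Ω \ {x | 1 / ((n : ℝ) + 1) ≤ g x})) atTop (𝓝 0) := by
    have h := tendsto_measure_iInter_atTop (μ := μ)
      (s := fun n : ℕ => Ω \ {x | 1 / ((n : ℝ) + 1) ≤ g x})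
      (fun n => (hΩ.measurableSet.diff
        (measurableSet_le measurable_const hgm)).nullMeasurableSet)
      (fun n m hnm => sdiff_subset_sdiff_right fun x hx =>
        le_trans (one_div_le_one_div_of_le (by positivity) (by gcongr)) (mem_ofPred_eq ▸ hx))
      ⟨0, ne_top_of_le_ne_top (hμ Ω hΩb).ne (measure_mono sdiff_subset)⟩
    have hempty : ⋂ n : ℕ, (Ω \ {x | 1 / ((n : ℝ) + 1) ≤ g x}) = ∅ := by
      refine eq_empty_of_forall_notMem fun x hx => ?_
      rw [mem_iInter] at hx
      obtain ⟨n, hn⟩ := exists_nat_one_div_lt (hgpos x (hx 0).1)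
      exact (hx n).2 hn.le
    rwa [hempty, measure_empty] at h
  obtain ⟨n, hn⟩ := (hlim.eventually_lt_const hε).exists
  have hpos : (0 : ℝ) < 1 / ((n : ℝ) + 1) := by positivity
  -- Almost every level has finite perimeter, and the interval has positive length.
  obtain ⟨s, hs, hs1, hs2⟩ : ∃ s ∈ Ioo (0 : ℝ) (1 / ((n : ℝ) + 1)),
      perimeter μ univ {x | s ≤ g x} ≤ p s ∧ p s < ∞ := by
    by_contra hcon
    push Not at hcon
    have hnull : volume (Ioo (0 : ℝ) (1 / ((n : ℝ) + 1))) = 0 := by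
      refine measure_mono_null (fun s hs => ?_) (hp.and hpfin)
      exact fun h => absurd h.2 (hcon s hs h.1).not_gt
    rw [Real.volume_Ioo, sub_zero, ENNReal.ofReal_eq_zero] at hnull
    exact hnull.not_gt hpos
  refine ⟨{x | s ≤ g x}, fun x hx => ?_, isClosed_le continuous_const hgL.continuous,
    hs1.trans_lt hs2, (measure_mono (sdiff_subset_sdiff_right fun x hx => ?_)).trans_lt hn⟩
  · by_contra hxΩ
    have hx' : s ≤ g x := hx
    rw [hg0 x hxΩ] at hx'
    exact hs.1.not_ge hx'
  · exact hs.2.le.trans hx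

omit [BorelSpace X] in
/-- The consequence of minimality for the perimeter of closed subsets. -/
lemma IsMinimalElement.perimeter_le {G F : Set X} (hG : IsMinimalElement μ Ω lam G)
    (hΩt : μ Ω ≠ ∞) (hF : IsClosed F) (hFG : F ⊆ G) :
    perimeter μ univ G ≤ perimeter μ univ F + lam * μ (G \ F) := by
  have hle : perimeterFunctional μ Ω lam G ≤ perimeterFunctional μ Ω lam F := by
    by_contra hlt
    rw [not_le] at hlt
    have h := hG.2 F ⟨hF, hFG.trans hG.1.2.1, hlt.trans hG.1.2.2⟩
      ⟨by rw [sdiff_eq_empty.2 hFG, measure_empty], hlt.le⟩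
    exact hlt.not_ge h.2
  have hsub : μ (Ω \ F) ≤ μ (G \ F) + μ (Ω \ G) := by
    rw [add_comm]
    exact measure_sdiff_le_add _ _ _
  have hfin : (lam : ℝ≥0∞) * μ (Ω \ G) ≠ ∞ := ENNReal.mul_ne_top ENNReal.coe_ne_top
    (ne_top_of_le_ne_top hΩt (measure_mono sdiff_subset))
  refine (ENNReal.add_le_add_iff_right hfin).1 ?_
  calc _ ≤ perimeter μ univ F + lam * μ (Ω \ F) := hle
    _ ≤ perimeter μ univ F + lam * (μ (G \ F) + μ (Ω \ G)) := by gcongr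
    _ = _ := by ring

end Minimal

/-! ### Cutoff functions between a closed set and an open neighbourhood. -/

section Cutoff

variable {X : Type*} [MetricSpace X]

lemma asympLip_inv_lt_top {f : X → ℝ} {x : X} (hf : asympLip f x < ∞) (hx : f x ≠ 0) :
    asympLip (fun y => (f y)⁻¹) x < ∞ := by
  obtain ⟨K, s, hs, hK⟩ := asympLip_lt_top_iff.1 hf
  obtain ⟨L, t, ht, hL⟩ := (contDiffAt_inv ℝ hx (n := 1)).exists_lipschitzOnWith
  exact asympLip_lt_top_iff.2 ⟨L * K, s ∩ f ⁻¹' t,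
    inter_mem hs ((continuousAt_of_asympLip hf).preimage_mem_nhds ht),
    hL.comp (hK.mono inter_subset_left) fun y hy => hy.2⟩

/-- The distance from `G` to `Aᶜ` may be 0, so only a locally Lipschitz cutoff is available, a
function of `a / (a + b)`. It is constant near each point of `G` and of `Aᶜ`: a product with it
keeps its `lip_a` on `G` and extends by zero across the boundary of `A`. -/
lemma exists_locallyLipschitz_cutoff {G A : Set X} (hG : IsClosed G) (hA : IsOpen A)
    (hGA : G ⊆ A) :
    ∃ η : X → ℝ, LocallyLipschitz η ∧ (∀ x, η x ∈ Icc (0 : ℝ) 1) ∧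
      (∀ x ∈ G, ∀ᶠ y in 𝓝 x, η y = 1) ∧ ∀ x ∉ A, ∀ᶠ y in 𝓝 x, η y = 0 := by
  rcases G.eq_empty_or_nonempty with rfl | hGne
  · exact ⟨fun _ => 0, LocallyLipschitz.const 0, fun _ => by simp, by simp, by simp⟩
  rcases (Aᶜ).eq_empty_or_nonempty with hAe | hAne
  · rw [compl_empty_iff] at hAe
    subst hAe
    exact ⟨fun _ => 1, LocallyLipschitz.const 1, fun _ => by simp, by simp, by simp⟩
  set a : X → ℝ := fun x => infDist x G with ha
  set b : X → ℝ := fun x => infDist x Aᶜ with hb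
  have ha0 : ∀ x, 0 ≤ a x := fun x => infDist_nonneg
  have hb0 : ∀ x, 0 ≤ b x := fun x => infDist_nonneg
  have haL : LipschitzWith 1 a := lipschitz_infDist_pt _
  have hbL : LipschitzWith 1 b := lipschitz_infDist_pt _
  have haG : ∀ x ∈ G, a x = 0 := fun x hx => infDist_zero_of_mem hx
  have hbA : ∀ x ∉ A, b x = 0 := fun x hx => infDist_zero_of_mem hx
  have hbpos : ∀ x ∈ A, 0 < b x := fun x hx =>
    (hA.isClosed_compl.notMem_iff_infDist_pos hAne).1 fun h => h hx
  have hapos : ∀ x ∉ G, 0 < a x := fun x hx => (hG.notMem_iff_infDist_pos hGne).1 hx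
  have hpos : ∀ x, 0 < a x + b x := by
    intro x
    by_cases hx : x ∈ A
    · linarith [ha0 x, hbpos x hx]
    · linarith [hb0 x, hapos x fun h => hx (hGA h)]
  have hq : ∀ x, asympLip (fun y => a y * (a y + b y)⁻¹) x < ∞ := by
    intro x
    have h1 := LipschitzWith.asympLip_lt_top (x := x) haL
    have h2 := LipschitzWith.asympLip_lt_top (x := x) (haL.add hbL)
    have h3 := asympLip_inv_lt_top h2 (hpos x).ne'
    exact (asympLip_mul_le h1 h3).trans_lt (ENNReal.add_lt_top.2
      ⟨ENNReal.mul_lt_top enorm_lt_top h3, ENNReal.mul_lt_top enorm_lt_top h1⟩)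
  have hφ : LipschitzWith (1 * (0 + ‖(3 : ℝ)‖₊)) fun t : ℝ => clamp (2 - 3 * t) :=
    lipschitzWith_clamp.comp ((LipschitzWith.const 2).sub
      (by simpa using lipschitzWith_smul (α := ℝ) (β := ℝ) 3))
  have hcont : Continuous fun y => a y * (a y + b y)⁻¹ :=
    haL.continuous.mul ((haL.continuous.add hbL.continuous).inv₀ fun x => (hpos x).ne')
  refine ⟨fun x => clamp (2 - 3 * (a x * (a x + b x)⁻¹)),
    hφ.locallyLipschitz.comp (locallyLipschitz_iff.2 hq), fun x => clamp_mem _, fun x hx => ?_,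
    fun x hx => ?_⟩
  · have : a x * (a x + b x)⁻¹ < 1 / 3 := by rw [haG x hx]; norm_num
    filter_upwards [hcont.continuousAt.eventually_lt_const this] with y hy
    exact clamp_of_one_le (by linarith)
  · have : 2 / 3 < a x * (a x + b x)⁻¹ := by
      rw [hbA x hx, add_zero, mul_inv_cancel₀ (hapos x fun h => hx (hGA h)).ne']
      norm_num
    filter_upwards [hcont.continuousAt.eventually_const_lt this] with y hy
    exact clamp_of_nonpos (by linarith)

lemma locallyBoundedFun_asympLip {f : X → ℝ} (hf : LocallyLipschitz f) :
    LocallyBoundedFun (asympLip f) := by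
  intro x
  obtain ⟨r, hr, L, -, hL⟩ := exists_ball_lipschitzOnWith (hf.asympLip_lt_top x)
  exact ⟨r, hr, L, fun y hy => asympLip_le_of_mem_nhds (isOpen_ball.mem_nhds hy) hL⟩

lemma LocallyBoundedFun.add {h k : X → ℝ≥0∞} (hh : LocallyBoundedFun h)
    (hk : LocallyBoundedFun k) : LocallyBoundedFun fun x => h x + k x := by
  intro x
  obtain ⟨r, hr, C, hC⟩ := hh x
  obtain ⟨s, hs, D, hD⟩ := hk x
  refine ⟨min r s, lt_min hr hs, C + D, fun y hy => ?_⟩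
  rw [ENNReal.coe_add]
  exact add_le_add (hC y (ball_subset_ball (min_le_left _ _) hy))
    (hD y (ball_subset_ball (min_le_right _ _) hy))

lemma asympLip_mul_lt_top {f g : X → ℝ} {x : X} (hf : asympLip f x < ∞) (hg : asympLip g x < ∞) :
    asympLip (fun y => f y * g y) x < ∞ :=
  (asympLip_mul_le hf hg).trans_lt (ENNReal.add_lt_top.2
    ⟨ENNReal.mul_lt_top enorm_lt_top hg, ENNReal.mul_lt_top enorm_lt_top hf⟩)

lemma lipschitzWith_one_sub : LipschitzWith 1 fun t : ℝ => 1 - t :=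
  LipschitzWith.of_dist_le_mul fun s t => by
    rw [dist_sub_left, NNReal.coe_one, one_mul]

lemma locallyLipschitz_cutoff_mul {η u : X → ℝ} {A : Set X} (hη : LocallyLipschitz η)
    (hηA : ∀ x ∉ A, ∀ᶠ y in 𝓝 x, η y = 0) (hu : ∀ x ∈ A, asympLip u x < ∞) :
    LocallyLipschitz fun x => η x * u x := by
  rw [locallyLipschitz_iff]
  intro x
  by_cases hx : x ∈ A
  · exact asympLip_mul_lt_top (hη.asympLip_lt_top x) (hu x hx)
  · rw [asympLip_eq_zero_of_eventuallyEq (c := 0)]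
    · simp
    · filter_upwards [hηA x hx] with y hy using by rw [hy, zero_mul]

end Cutoff

/-! ### The extension inequality for functions with values in `[0, 1]`. -/

section Extension

variable {X : Type*} [MetricSpace X] [MeasurableSpace X] [BorelSpace X] {μ : Measure X}
  {Ω G A : Set X} {lam : ℝ≥0} {u : X → ℝ}

lemma measurable_indicator_of_continuousOn (hG : MeasurableSet G) (hu : ContinuousOn u G) :
    Measurable (G.indicator u) := by
  classical
  rw [← piecewise_eq_indicator]
  exact hu.measurable_piecewise continuousOn_const hG

/-- A closed set of finite perimeter, cut by a locally Lipschitz function `u` with values in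
`[0, 1]`: the pieces `u χ_G` and `(1 - u) χ_G` have approximations whose energies add up to at most
`Per(G) + 2 ∫_G lip_a(u)`. -/
lemma exists_approx_pair [SecondCountableTopology X]
    (hμ : ∀ s : Set X, Bornology.IsBounded s → μ s < ∞) (hG : IsClosed G)
    (hP : perimeter μ univ G < ∞) (hA : IsOpen A) (hGA : G ⊆ A) (hu : LocallyLipschitzOn A u)
    (hu01 : ∀ x, u x ∈ Icc (0 : ℝ) 1) {δ : ℝ≥0∞} (hδ : 0 < δ) :
    ∃ w₁ w₂ : X → ℝ, LocallyLipschitz w₁ ∧ LocallyLipschitz w₂ ∧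
      ∫⁻ x, ‖w₁ x - G.indicator u x‖ₑ ∂μ ≤ δ ∧
      ∫⁻ x, ‖w₂ x - G.indicator (fun x => 1 - u x) x‖ₑ ∂μ ≤ δ ∧
      ∫⁻ x, asympLip w₁ x ∂μ + ∫⁻ x, asympLip w₂ x ∂μ ≤
        perimeter μ univ G + 2 * ∫⁻ x in G, asympLip u x ∂μ + δ := by
  obtain ⟨η, hη, hη01, hηG, hηA⟩ := exists_locallyLipschitz_cutoff hG hA hGA
  have hu' := (locallyLipschitzOn_iff hA).1 hu
  have hu1' : ∀ x ∈ A, asympLip (fun y => 1 - u y) x ≤ asympLip u x := fun x hx =>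
    asympLip_comp_le_of_one lipschitzWith_one_sub (hu' x hx)
  set U : X → ℝ := fun x => η x * u x with hU
  set V : X → ℝ := fun x => η x * (1 - u x) with hV
  have hUL : LocallyLipschitz U := locallyLipschitz_cutoff_mul hη hηA hu'
  have hVL : LocallyLipschitz V := locallyLipschitz_cutoff_mul hη hηA fun x hx =>
    (hu1' x hx).trans_lt (hu' x hx)
  have hUlip : ∀ x ∈ G, asympLip U x = asympLip u x := fun x hx => asympLip_congr (by
    filter_upwards [hηG x hx] with y hy using by simp [hU, hy])
  have hVlip : ∀ x ∈ G, asympLip V x ≤ asympLip u x := fun x hx =>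
    (asympLip_congr (by filter_upwards [hηG x hx] with y hy using by simp [hV, hy])).trans_le
      (hu1' x (hGA hx))
  have hU0 : ∀ x, 0 ≤ U x := fun x => mul_nonneg (hη01 x).1 (hu01 x).1
  have hV0 : ∀ x, 0 ≤ V x := fun x => mul_nonneg (hη01 x).1 (sub_nonneg.2 (hu01 x).2)
  have hUV : ∀ x, U x + V x ≤ 1 := fun x => by
    rw [hU, hV, ← mul_add, add_sub_cancel, mul_one]
    exact (hη01 x).2
  set χ : X → ℝ := G.indicator fun _ => 1 with hχ
  have hχm : Measurable χ := measurable_const.indicator hG.measurableSet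
  set k : X → ℝ≥0∞ := fun x => asympLip U x + asympLip V x with hk
  have hkm : Measurable k := (measurable_asympLip _).add (measurable_asympLip _)
  -- `k` is the weight in the Leibniz error; the added 1 makes weighted closeness imply closeness in
  -- `L¹`.
  have hh : LocallyBoundedFun fun x => k x + 1 :=
    ((locallyBoundedFun_asympLip hUL).add (locallyBoundedFun_asympLip hVL)).add
      fun x => ⟨1, one_pos, 1, fun _ _ => by simp⟩
  obtain ⟨v, hv, hv1, hv2⟩ := (approxBV_of_perimeter_lt_top hμ hP).exists_weighted hχm hP.ne hh
    (ENNReal.half_pos hδ.ne')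
  have hvm : Measurable v := hv.continuous.measurable
  have hvχ : Measurable fun x => ‖v x - χ x‖ₑ := (hvm.sub hχm).enorm
  have hL1 : ∫⁻ x, ‖v x - χ x‖ₑ ∂μ ≤ δ := by
    refine (lintegral_mono fun x => ?_).trans (hv2.trans ENNReal.half_le_self)
    exact le_mul_of_one_le_left' le_add_self
  have hclose : ∀ (W f : X → ℝ), (∀ x, 0 ≤ W x) → (∀ x, W x ≤ 1) → (∀ x ∈ G, W x = f x) →
      ∫⁻ x, ‖W x * v x - G.indicator f x‖ₑ ∂μ ≤ δ := by
    intro W f hW0 hW1 hWf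
    refine (lintegral_mono fun x => ?_).trans hL1
    have : W x * v x - G.indicator f x = W x * (v x - χ x) := by
      by_cases hx : x ∈ G <;> simp [hχ, hx, mul_sub]
      exact (hWf x hx).symm
    rw [this, enorm_mul, Real.enorm_of_nonneg (hW0 x)]
    exact mul_le_of_le_one_left' (ENNReal.ofReal_le_one.2 (hW1 x))
  have hηG1 : ∀ x ∈ G, η x = 1 := fun x hx => (hηG x hx).self_of_nhds
  have hprod : ∀ (W : X → ℝ), LocallyLipschitz W → LocallyLipschitz fun x => W x * v x :=
    fun W hW => locallyLipschitz_iff.2 fun x =>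
      asympLip_mul_lt_top (hW.asympLip_lt_top x) (hv.asympLip_lt_top x)
  refine ⟨fun x => U x * v x, fun x => V x * v x, hprod U hUL, hprod V hVL,
    hclose U u hU0 (fun x => (le_add_of_nonneg_right (hV0 x)).trans (hUV x))
      (fun x hx => by simp [hU, hηG1 x hx]),
    hclose V _ hV0 (fun x => (le_add_of_nonneg_left (hU0 x)).trans (hUV x))
      (fun x hx => by simp [hV, hηG1 x hx]), ?_⟩
  rw [← lintegral_add_left (measurable_asympLip _)]
  -- Because `U + V ≤ 1`, the energy of `v` is counted once for both products together. In the other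
  -- Leibniz term `|v|` is compared with `χ`, which leaves `k` on `G` and the weighted error.
  have hpt : ∀ x, asympLip (fun x => U x * v x) x + asympLip (fun x => V x * v x) x ≤
      asympLip v x + (G.indicator k x + (k x + 1) * ‖v x - χ x‖ₑ) := by
    intro x
    have h1 := asympLip_mul_le (hUL.asympLip_lt_top x) (hv.asympLip_lt_top x)
    have h2 := asympLip_mul_le (hVL.asympLip_lt_top x) (hv.asympLip_lt_top x)
    have h3 : ‖U x‖ₑ + ‖V x‖ₑ ≤ 1 := by
      rw [Real.enorm_of_nonneg (hU0 x), Real.enorm_of_nonneg (hV0 x),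
        ← ENNReal.ofReal_add (hU0 x) (hV0 x)]
      exact ENNReal.ofReal_le_one.2 (hUV x)
    have h4 : ‖v x‖ₑ ≤ ‖χ x‖ₑ + ‖v x - χ x‖ₑ := by
      calc ‖v x‖ₑ = ‖χ x + (v x - χ x)‖ₑ := by congr 1; ring
        _ ≤ _ := enorm_add_le _ _
    have h5 : ‖χ x‖ₑ * k x = G.indicator k x := by
      by_cases hx : x ∈ G <;> simp [hχ, hx]
    calc _ ≤ (‖U x‖ₑ * asympLip v x + ‖v x‖ₑ * asympLip U x) +
          (‖V x‖ₑ * asympLip v x + ‖v x‖ₑ * asympLip V x) := add_le_add h1 h2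
      _ = (‖U x‖ₑ + ‖V x‖ₑ) * asympLip v x + ‖v x‖ₑ * k x := by rw [hk]; ring
      _ ≤ 1 * asympLip v x + (‖χ x‖ₑ + ‖v x - χ x‖ₑ) * k x := by gcongr
      _ = asympLip v x + (G.indicator k x + k x * ‖v x - χ x‖ₑ) := by rw [← h5]; ring
      _ ≤ _ := by gcongr; exact le_self_add
  have hkG : ∫⁻ x, G.indicator k x ∂μ ≤ 2 * ∫⁻ x in G, asympLip u x ∂μ := by
    rw [lintegral_indicator hG.measurableSet, ← lintegral_const_mul _ (measurable_asympLip _)]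
    refine setLIntegral_mono' hG.measurableSet fun x hx => ?_
    rw [two_mul]
    exact add_le_add (hUlip x hx).le (hVlip x hx)
  calc _ ≤ _ := lintegral_mono hpt
    _ = ∫⁻ x, asympLip v x ∂μ + (∫⁻ x, G.indicator k x ∂μ +
        ∫⁻ x, (k x + 1) * ‖v x - χ x‖ₑ ∂μ) := by
      rw [lintegral_add_left (measurable_asympLip _),
        lintegral_add_left (hkm.indicator hG.measurableSet)]
    _ ≤ perimeter μ univ G + δ / 2 + (2 * ∫⁻ x in G, asympLip u x ∂μ + δ / 2) := by gcongr
    _ = perimeter μ univ G + 2 * ∫⁻ x in G, asympLip u x ∂μ + (δ / 2 + δ / 2) := by ring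
    _ = _ := by rw [ENNReal.add_halves]

/-- If `G` is minimal, `0 ≤ u ≤ 1` and `(1 - u) χ_G` has variation at most `C`, then
`Per(G) ≤ C + λ ∫_G u`. -/
lemma IsMinimalElement.perimeter_le_of_approxBV [SecondCountableTopology X]
    (hμ : ∀ s : Set X, Bornology.IsBounded s → μ s < ∞) (hΩt : μ Ω ≠ ∞)
    (hG : IsMinimalElement μ Ω lam G) (hu : ContinuousOn u G) (hum : Measurable (G.indicator u))
    (hu01 : ∀ x, u x ∈ Icc (0 : ℝ) 1) {C : ℝ≥0∞}
    (hC : ApproxBV μ (G.indicator fun x => 1 - u x) C) :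
    perimeter μ univ G ≤ C + lam * ∫⁻ x in G, ENNReal.ofReal (u x) ∂μ := by
  have hGc : IsClosed G := hG.1.1
  have hGm := hGc.measurableSet
  have hm : Measurable (G.indicator fun x => 1 - u x) := by
    have : (G.indicator fun x => 1 - u x) = G.indicator (fun x => 1 - G.indicator u x) := by
      ext x
      by_cases hx : x ∈ G <;> simp [hx]
    rw [this]
    exact (measurable_const.sub hum).indicator hGm
  obtain ⟨p, hpm, hp, hpC⟩ := hC.exists_levelSet_bound hμ hm
  -- The level `1 - t` of `(1 - u) χ_G` corresponds to the sublevel set `G ∩ {u ≤ t}`; for `t < 1`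
  -- no point outside `G` enters.
  have hp' : ∀ᵐ t : ℝ, perimeter μ univ {x | 1 - t ≤ G.indicator (fun x => 1 - u x) x} ≤
      p (1 - t) :=
    (Measure.measurePreserving_sub_left volume (1 : ℝ)).quasiMeasurePreserving.ae hp
  have key : ∀ᵐ t : ℝ, t ∈ Ioo (0 : ℝ) 1 → perimeter μ univ G ≤
      p (1 - t) + lam * μ.restrict G {x | t < G.indicator u x} := by
    filter_upwards [hp'] with t ht ht01
    have hF : {x | 1 - t ≤ G.indicator (fun x => 1 - u x) x} = G ∩ u ⁻¹' Iic t := by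
      ext x
      by_cases hx : x ∈ G
      · simp only [mem_ofPred_eq, indicator_of_mem hx, mem_inter_iff, hx, true_and, mem_preimage,
          mem_Iic]
        constructor <;> intro h <;> linarith
      · simpa [hx] using ht01.2
    have hFc : IsClosed (G ∩ u ⁻¹' Iic t) := hu.preimage_isClosed_of_isClosed hGc isClosed_Iic
    have hGF : μ.restrict G {x | t < G.indicator u x} = μ (G \ (G ∩ u ⁻¹' Iic t)) := by
      rw [Measure.restrict_apply (measurableSet_lt measurable_const hum)]
      congr 1
      ext x
      by_cases hx : x ∈ G <;> simp [hx]
    rw [hF] at ht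
    rw [hGF]
    exact (hG.perimeter_le hΩt hFc inter_subset_left).trans (by gcongr)
  have hlayer : ∫⁻ x in G, ENNReal.ofReal (u x) ∂μ =
      ∫⁻ t in Ioi (0 : ℝ), μ.restrict G {x | t < G.indicator u x} := by
    rw [← lintegral_eq_lintegral_meas_lt _ (Eventually.of_forall fun x => ?_) hum.aemeasurable]
    · exact setLIntegral_congr_fun hGm fun x hx => by simp [hx]
    · exact indicator_nonneg (fun x _ => (hu01 x).1) x
  have hpm' : Measurable fun t => p (1 - t) := hpm.comp (measurable_const.sub measurable_id)
  calc perimeter μ univ G = ∫⁻ t in Ioo (0 : ℝ) 1, perimeter μ univ G := by simp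
    _ ≤ ∫⁻ t in Ioo (0 : ℝ) 1, (p (1 - t) + lam * μ.restrict G {x | t < G.indicator u x}) :=
        lintegral_mono_ae ((ae_restrict_iff' measurableSet_Ioo).2 key)
    _ = (∫⁻ t in Ioo (0 : ℝ) 1, p (1 - t)) +
        lam * ∫⁻ t in Ioo (0 : ℝ) 1, μ.restrict G {x | t < G.indicator u x} := by
      rw [lintegral_add_left hpm', lintegral_const_mul' _ _ ENNReal.coe_ne_top]
    _ ≤ (∫⁻ t, p (1 - t)) + lam * ∫⁻ t in Ioi (0 : ℝ), μ.restrict G {x | t < G.indicator u x} := by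
      gcongr
      · exact Measure.restrict_le_self
      · exact Ioo_subset_Ioi_self
    _ ≤ _ := by
      rw [hlayer, lintegral_sub_left_eq_self p]
      gcongr

/-- The extension inequality for locally Lipschitz functions with values in `[0, 1]`. -/
lemma IsMinimalElement.approxBV_indicator [SecondCountableTopology X]
    (hμ : ∀ s : Set X, Bornology.IsBounded s → μ s < ∞) (hΩb : Bornology.IsBounded Ω)
    (hG : IsMinimalElement μ Ω lam G) (hA : IsOpen A) (hGA : G ⊆ A)
    (hu : LocallyLipschitzOn A u) (hu01 : ∀ x, u x ∈ Icc (0 : ℝ) 1)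
    (hfin : ∫⁻ x in G, asympLip u x ∂μ ≠ ∞) :
    ApproxBV μ (G.indicator u)
      (2 * ∫⁻ x in G, asympLip u x ∂μ + lam * ∫⁻ x in G, ENNReal.ofReal (u x) ∂μ) := by
  have hGc : IsClosed G := hG.1.1
  have hP : perimeter μ univ G < ∞ := lt_of_le_of_lt le_self_add hG.1.2.2
  set P := perimeter μ univ G with hPdef
  set L := 2 * ∫⁻ x in G, asympLip u x ∂μ with hL
  set m := lam * ∫⁻ x in G, ENNReal.ofReal (u x) ∂μ with hm
  have hLt : L ≠ ∞ := ENNReal.mul_ne_top (by simp) hfin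
  -- The estimate on the pair bounds only a sum of energies. If every `w₁` close to `u χ_G` costs
  -- more than `L + m + δ₀`, then the partner `w₂` is cheap, so `(1 - u) χ_G` has variation at most
  -- `P - (m + δ₀)`, in conflict with minimality.
  by_contra hcon
  simp only [ApproxBV, not_forall, not_exists, not_and, not_le] at hcon
  obtain ⟨B, hB, δ₀, hδ₀, hcon⟩ := hcon
  have key : ∀ δ : ℝ≥0∞, 0 < δ → ∃ w : X → ℝ, LocallyLipschitz w ∧
      ∫⁻ x, ‖w x - G.indicator (fun x => 1 - u x) x‖ₑ ∂μ ≤ δ ∧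
      m + δ₀ + ∫⁻ x, asympLip w x ∂μ ≤ P + δ := by
    intro δ hδ
    obtain ⟨w₁, w₂, hw₁, hw₂, h1, h2, h3⟩ :=
      exists_approx_pair hμ hGc hP hA hGA hu hu01 (lt_min hδ hδ₀)
    refine ⟨w₂, hw₂, h2.trans (min_le_left _ _), ?_⟩
    have h4 := hcon w₁ hw₁
      ((setLIntegral_le_lintegral _ _).trans (h1.trans (min_le_right _ _)))
    refine (ENNReal.add_le_add_iff_left hLt).1 ?_
    calc L + (m + δ₀ + ∫⁻ x, asympLip w₂ x ∂μ) = (L + m + δ₀) + ∫⁻ x, asympLip w₂ x ∂μ := by ring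
      _ ≤ ∫⁻ x, asympLip w₁ x ∂μ + ∫⁻ x, asympLip w₂ x ∂μ := by gcongr
      _ ≤ P + L + min δ δ₀ := h3
      _ ≤ P + L + δ := by gcongr; exact min_le_left _ _
      _ = _ := by ring
  have hmP : m + δ₀ ≤ P := by
    refine ENNReal.le_of_forall_pos_le_add fun ε hε _ => ?_
    obtain ⟨w, -, -, h⟩ := key ε (by exact_mod_cast hε)
    exact le_self_add.trans h
  have hmt : m + δ₀ ≠ ∞ := ne_top_of_le_ne_top hP.ne hmP
  have hAp : ApproxBV μ (G.indicator fun x => 1 - u x) (P - (m + δ₀)) := by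
    intro B' _ δ hδ
    obtain ⟨w, hw, h1, h2⟩ := key δ hδ
    refine ⟨w, hw, (setLIntegral_le_lintegral _ _).trans h1, ?_⟩
    refine (ENNReal.add_le_add_iff_left hmt).1 (h2.trans (le_of_eq ?_))
    rw [← add_assoc, add_tsub_cancel_of_le hmP]
  have hucont : ContinuousOn u G := hu.continuousOn.mono hGA
  have hum : Measurable (G.indicator u) :=
    measurable_indicator_of_continuousOn hGc.measurableSet hucont
  have hfinal := hG.perimeter_le_of_approxBV hμ (hμ Ω hΩb).ne hucont hum hu01 hAp
  have : P + δ₀ ≤ P + 0 := by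
    calc P + δ₀ ≤ P - (m + δ₀) + m + δ₀ := by gcongr
      _ = P - (m + δ₀) + (m + δ₀) := by ring
      _ = P + 0 := by rw [tsub_add_cancel_of_le hmP, add_zero]
  exact hδ₀.not_ge ((ENNReal.add_le_add_iff_left hP.ne).1 this)

end Extension

/-! ### Truncation and soft thresholding of real values. -/

section Truncation

variable {X : Type*} [MetricSpace X] {u : X → ℝ} {x : X}

/-- Truncation of real numbers to `[-M, M]`. -/
def trunc (M t : ℝ) : ℝ := max (-M) (min t M)

lemma lipschitzWith_trunc (M : ℝ) : LipschitzWith 1 (trunc M) :=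
  (LipschitzWith.id.min_const M).const_max (-M)

lemma abs_trunc_le {M : ℝ} (hM : 0 ≤ M) (t : ℝ) : |trunc M t| ≤ M :=
  abs_le.2 ⟨le_max_left _ _, max_le (by linarith) (min_le_right _ _)⟩

lemma trunc_of_abs_le {M t : ℝ} (ht : |t| ≤ M) : trunc M t = t := by
  rw [abs_le] at ht
  rw [trunc, min_eq_left ht.2, max_eq_right ht.1]

lemma trunc_zero {M : ℝ} (hM : 0 ≤ M) : trunc M 0 = 0 := trunc_of_abs_le (by simpa using hM)

lemma enorm_trunc_le {M : ℝ} (hM : 0 ≤ M) (t : ℝ) : ‖trunc M t‖ₑ ≤ ‖t‖ₑ := by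
  have := enorm_sub_le_of_lipschitzWith_one (lipschitzWith_trunc M) t 0
  simpa [trunc_zero hM] using this

lemma enorm_trunc_sub_le {M : ℝ} (hM : 0 ≤ M) (t : ℝ) : ‖trunc M t - t‖ₑ ≤ ‖t‖ₑ := by
  rw [enorm_le_iff_norm_le, Real.norm_eq_abs, Real.norm_eq_abs]
  rcases le_total |t| M with h | h
  · rw [trunc_of_abs_le h, sub_self, abs_zero]
    exact abs_nonneg t
  · rcases le_total 0 t with h0 | h0
    · rw [abs_of_nonneg h0] at h ⊢
      rw [trunc, min_eq_right h, max_eq_right (by linarith), abs_le]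
      constructor <;> linarith
    · rw [abs_of_nonpos h0] at h ⊢
      rw [trunc, min_eq_left (by linarith), max_eq_left (by linarith), abs_le]
      constructor <;> linarith

/-- The function `t ↦ (t - c)⁺`. -/
def posPartSub (c t : ℝ) : ℝ := max 0 (t - c)

lemma lipschitzWith_posPartSub (c : ℝ) : LipschitzWith 1 (posPartSub c) :=
  LipschitzWith.const_max (LipschitzWith.of_dist_le_mul fun s t => by simp) 0

lemma posPartSub_nonneg (c t : ℝ) : 0 ≤ posPartSub c t := le_max_left _ _

lemma lipschitzWith_posPartSub_neg (c : ℝ) : LipschitzWith 1 fun t => posPartSub c (-t) := by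
  have h : LipschitzWith 1 fun t : ℝ => -t := LipschitzWith.of_dist_le_mul fun s t => by simp
  have := (lipschitzWith_posPartSub c).comp h
  rwa [one_mul] at this

lemma posPartSub_eq_zero {c t : ℝ} (h : t ≤ c) : posPartSub c t = 0 := max_eq_left (by linarith)

lemma posPartSub_mem_Icc {c t M : ℝ} (hc : 0 ≤ c) (ht : |t| ≤ M) : posPartSub c t ∈ Icc 0 M :=
  ⟨le_max_left _ _, max_le ((abs_nonneg t).trans ht) (by linarith [le_abs_self t])⟩

lemma posPartSub_add_neg_le {c : ℝ} (hc : 0 ≤ c) (t : ℝ) :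
    posPartSub c t + posPartSub c (-t) ≤ |t| := by
  unfold posPartSub
  rcases le_total 0 t with h | h
  · rw [abs_of_nonneg h, max_eq_left (b := -t - c) (by linarith), add_zero]
    exact max_le h (by linarith)
  · rw [abs_of_nonpos h, max_eq_left (b := t - c) (by linarith), zero_add]
    exact max_le (by linarith) (by linarith)

lemma abs_posPartSub_sub_neg_sub_le {c : ℝ} (hc : 0 ≤ c) (t : ℝ) :
    |posPartSub c t - posPartSub c (-t) - t| ≤ c := by
  unfold posPartSub
  rw [abs_le]
  rcases max_cases 0 (t - c) with ⟨h1, h2⟩ | ⟨h1, h2⟩ <;>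
  rcases max_cases 0 (-t - c) with ⟨h3, h4⟩ | ⟨h3, h4⟩ <;>
  rw [h1, h3] <;> constructor <;> linarith

/-- For `c > 0` one of the two functions vanishes near `x`. With plain positive and negative parts
both can have the full constant `lip_a(u)` at a zero of `u`, which would double the bound. -/
lemma asympLip_posPartSub_add_le {c : ℝ} (hc : 0 < c) (hu : asympLip u x < ∞) :
    asympLip (fun y => posPartSub c (u y)) x + asympLip (fun y => posPartSub c (-u y)) x ≤
      asympLip u x := by
  have hcont := continuousAt_of_asympLip hu
  rcases lt_or_ge (u x) c with h | h
  · have h0 : asympLip (fun y => posPartSub c (u y)) x = 0 :=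
      asympLip_eq_zero_of_eventuallyEq (c := 0)
        ((hcont.eventually_lt_const h).mono fun y hy => posPartSub_eq_zero hy.le)
    rw [h0, zero_add]
    exact asympLip_comp_le_of_one (φ := fun t => posPartSub c (-t))
      (lipschitzWith_posPartSub_neg c) hu
  · have h0 : asympLip (fun y => posPartSub c (-u y)) x = 0 :=
      asympLip_eq_zero_of_eventuallyEq (c := 0)
        ((hcont.eventually_const_lt (show -c < u x by linarith)).mono fun y hy =>
          posPartSub_eq_zero (by linarith))
    rw [h0, add_zero]
    exact asympLip_comp_le_of_one (φ := posPartSub c) (lipschitzWith_posPartSub c) hu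

end Truncation

/-! ### The extension inequality for general functions of bounded variation. -/

section Extension

variable {X : Type*} [MetricSpace X] [MeasurableSpace X] [BorelSpace X] {μ : Measure X}
  {Ω G A : Set X} {lam : ℝ≥0} {u f : X → ℝ}

omit [MeasurableSpace X] [BorelSpace X] in
lemma _root_.LocallyLipschitzOn.comp_lipschitzWith_one (hA : IsOpen A)
    (hu : LocallyLipschitzOn A u) {φ : ℝ → ℝ} (hφ : LipschitzWith 1 φ) :
    LocallyLipschitzOn A fun x => φ (u x) := by
  rw [locallyLipschitzOn_iff hA] at hu ⊢
  exact fun x hx => (asympLip_comp_le_of_one hφ (hu x hx)).trans_lt (hu x hx)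

/-- The extension inequality for bounded nonnegative locally Lipschitz functions. -/
lemma IsMinimalElement.approxBV_indicator_of_le [SecondCountableTopology X]
    (hμ : ∀ s : Set X, Bornology.IsBounded s → μ s < ∞) (hΩb : Bornology.IsBounded Ω)
    (hG : IsMinimalElement μ Ω lam G) (hA : IsOpen A) (hGA : G ⊆ A)
    (hu : LocallyLipschitzOn A u) {M : ℝ} (hM : 0 < M) (huM : ∀ x, u x ∈ Icc (0 : ℝ) M)
    (hfin : ∫⁻ x in G, asympLip u x ∂μ ≠ ∞) :
    ApproxBV μ (G.indicator u)
      (2 * ∫⁻ x in G, asympLip u x ∂μ + lam * ∫⁻ x in G, ENNReal.ofReal (u x) ∂μ) := by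
  have hGm : MeasurableSet G := hG.1.1.measurableSet
  have hu' := (locallyLipschitzOn_iff hA).1 hu
  have hle : ∀ x ∈ A, asympLip (fun y => M⁻¹ * u y) x ≤ ‖M⁻¹‖ₑ * asympLip u x := fun x hx =>
    asympLip_const_mul_le _ (hu' x hx)
  have hvL : LocallyLipschitzOn A fun y => M⁻¹ * u y := (locallyLipschitzOn_iff hA).2 fun x hx =>
    (hle x hx).trans_lt (ENNReal.mul_lt_top enorm_lt_top (hu' x hx))
  have hint : ∫⁻ x in G, asympLip (fun y => M⁻¹ * u y) x ∂μ ≤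
      ‖M⁻¹‖ₑ * ∫⁻ x in G, asympLip u x ∂μ := by
    rw [← lintegral_const_mul' _ _ enorm_ne_top]
    exact setLIntegral_mono' hGm fun x hx => hle x (hGA hx)
  have hv01 : ∀ x, M⁻¹ * u x ∈ Icc (0 : ℝ) 1 := fun x =>
    ⟨mul_nonneg (inv_nonneg.2 hM.le) (huM x).1, by
      rw [inv_mul_le_iff₀ hM, mul_one]; exact (huM x).2⟩
  -- Both sides of the inequality are homogeneous of degree 1, so dividing by `M` reduces to values
  -- in `[0, 1]`.
  have happ := (hG.approxBV_indicator hμ hΩb hA hGA hvL hv01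
    (ne_top_of_le_ne_top (ENNReal.mul_ne_top enorm_ne_top hfin) hint)).const_mul M
  have hMM : ‖M‖ₑ * ‖M⁻¹‖ₑ = 1 := by rw [← enorm_mul, mul_inv_cancel₀ hM.ne']; simp
  have hofReal : ∫⁻ x in G, ENNReal.ofReal (M⁻¹ * u x) ∂μ =
      ‖M⁻¹‖ₑ * ∫⁻ x in G, ENNReal.ofReal (u x) ∂μ := by
    rw [← lintegral_const_mul' _ _ enorm_ne_top]
    refine lintegral_congr fun x => ?_
    rw [Real.enorm_of_nonneg (inv_nonneg.2 hM.le), ENNReal.ofReal_mul (inv_nonneg.2 hM.le)]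
  have hfun : (fun x => M * G.indicator (fun y => M⁻¹ * u y) x) = G.indicator u := by
    ext x
    by_cases hx : x ∈ G
    · simp [hx, mul_inv_cancel_left₀ hM.ne']
    · simp [hx]
  rw [hfun] at happ
  refine happ.mono ?_
  calc _ ≤ ‖M‖ₑ * (2 * (‖M⁻¹‖ₑ * ∫⁻ x in G, asympLip u x ∂μ) +
        lam * (‖M⁻¹‖ₑ * ∫⁻ x in G, ENNReal.ofReal (u x) ∂μ)) := by rw [hofReal]; gcongr
    _ = (‖M‖ₑ * ‖M⁻¹‖ₑ) * (2 * ∫⁻ x in G, asympLip u x ∂μ +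
        lam * ∫⁻ x in G, ENNReal.ofReal (u x) ∂μ) := by ring
    _ = _ := by rw [hMM, one_mul]

/-- The extension inequality for a soft threshold of a bounded locally Lipschitz function. -/
lemma IsMinimalElement.approxBV_indicator_softThreshold [SecondCountableTopology X]
    (hμ : ∀ s : Set X, Bornology.IsBounded s → μ s < ∞) (hΩb : Bornology.IsBounded Ω)
    (hG : IsMinimalElement μ Ω lam G) (hA : IsOpen A) (hGA : G ⊆ A)
    (hu : LocallyLipschitzOn A u) {M c : ℝ} (hM : 0 < M) (hc : 0 < c) (huM : ∀ x, |u x| ≤ M)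
    (hfin : ∫⁻ x in G, asympLip u x ∂μ ≠ ∞) :
    ApproxBV μ (G.indicator fun x => posPartSub c (u x) - posPartSub c (-u x))
      (2 * ∫⁻ x in G, asympLip u x ∂μ + lam * ∫⁻ x in G, ‖u x‖ₑ ∂μ) := by
  have hGm : MeasurableSet G := hG.1.1.measurableSet
  have hu' := (locallyLipschitzOn_iff hA).1 hu
  set p : X → ℝ := fun x => posPartSub c (u x) with hp
  set q : X → ℝ := fun x => posPartSub c (-u x) with hq
  have hpL : LocallyLipschitzOn A p := hu.comp_lipschitzWith_one hA (lipschitzWith_posPartSub c)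
  have hqL : LocallyLipschitzOn A q :=
    hu.comp_lipschitzWith_one hA (lipschitzWith_posPartSub_neg c)
  have hpm : Measurable (G.indicator p) :=
    measurable_indicator_of_continuousOn hGm (hpL.continuousOn.mono hGA)
  have hlip : ∫⁻ x in G, asympLip p x ∂μ + ∫⁻ x in G, asympLip q x ∂μ ≤
      ∫⁻ x in G, asympLip u x ∂μ := by
    rw [← lintegral_add_left (measurable_asympLip p)]
    exact setLIntegral_mono' hGm fun x hx => asympLip_posPartSub_add_le hc (hu' x (hGA hx))
  have hval : ∫⁻ x in G, ENNReal.ofReal (p x) ∂μ + ∫⁻ x in G, ENNReal.ofReal (q x) ∂μ ≤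
      ∫⁻ x in G, ‖u x‖ₑ ∂μ := by
    have hpa : AEMeasurable (fun x => ENNReal.ofReal (p x)) (μ.restrict G) :=
      ((aemeasurable_indicator_iff hGm).1 hpm.aemeasurable).ennreal_ofReal
    rw [← lintegral_add_left' hpa]
    refine lintegral_mono fun x => ?_
    rw [← ENNReal.ofReal_add (posPartSub_nonneg _ _) (posPartSub_nonneg _ _),
      Real.enorm_eq_ofReal_abs]
    exact ENNReal.ofReal_le_ofReal (posPartSub_add_neg_le hc.le _)
  have h1 := hG.approxBV_indicator_of_le hμ hΩb hA hGA hpL hM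
    (fun x => posPartSub_mem_Icc hc.le (huM x)) (ne_top_of_le_ne_top hfin (le_self_add.trans hlip))
  have h2 := (hG.approxBV_indicator_of_le hμ hΩb hA hGA hqL hM
    (fun x => posPartSub_mem_Icc hc.le (by rw [abs_neg]; exact huM x))
    (ne_top_of_le_ne_top hfin (le_add_self.trans hlip))).const_mul (-1)
  have h3 := h1.add h2 hpm.aemeasurable
  have hfun : (fun x => G.indicator p x + -1 * G.indicator q x) =
      G.indicator fun x => p x - q x := by
    ext x
    by_cases hx : x ∈ G
    · simp [hx, sub_eq_add_neg]
    · simp [hx]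
  rw [hfun] at h3
  refine h3.mono ?_
  calc _ = 2 * (∫⁻ x in G, asympLip p x ∂μ + ∫⁻ x in G, asympLip q x ∂μ) +
        lam * (∫⁻ x in G, ENNReal.ofReal (p x) ∂μ + ∫⁻ x in G, ENNReal.ofReal (q x) ∂μ) := by
        rw [enorm_neg, enorm_one]; ring
    _ ≤ _ := by gcongr

omit [MetricSpace X] [BorelSpace X] in
lemma exists_trunc_approx (hf : Integrable f (μ.restrict G)) {δ : ℝ≥0∞} (hδ : 0 < δ) :
    ∃ M : ℝ, 0 < M ∧ ∫⁻ x in G, ‖trunc M (f x) - f x‖ₑ ∂μ ≤ δ := by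
  have hlim := tendsto_lintegral_of_dominated_convergence' (μ := μ.restrict G)
    (F := fun (n : ℕ) x => ‖trunc (n + 1) (f x) - f x‖ₑ) (f := fun _ => 0) (fun x => ‖f x‖ₑ)
    (fun n => (((lipschitzWith_trunc _).continuous.measurable.comp_aemeasurable
      hf.aemeasurable).sub hf.aemeasurable).enorm)
    (fun n => Eventually.of_forall fun x => enorm_trunc_sub_le (by positivity) _)
    hf.hasFiniteIntegral.ne (Eventually.of_forall fun x => ?_)
  · rw [lintegral_zero] at hlim
    obtain ⟨n, hn⟩ := ((ENNReal.tendsto_nhds_zero.1 hlim) δ hδ).exists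
    exact ⟨n + 1, by positivity, hn⟩
  · refine tendsto_const_nhds.congr' ?_
    filter_upwards [eventually_ge_atTop ⌈|f x|⌉₊] with n hn
    rw [trunc_of_abs_le, sub_self, enorm_zero]
    exact (Nat.ceil_le.1 hn).trans (by linarith)

/-- Zero extension from a minimal set does not increase the variation by more than the stated
amount. -/
lemma IsMinimalElement.approxBV_extension [SecondCountableTopology X]
    (hμ : ∀ s : Set X, Bornology.IsBounded s → μ s < ∞) (hΩb : Bornology.IsBounded Ω)
    (hG : IsMinimalElement μ Ω lam G) (hf : MemBV μ G f) :
    ApproxBV μ (G.indicator f)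
      (2 * totalVariation (μ.restrict G) f G + lam * ∫⁻ x in G, ‖f x‖ₑ ∂μ) := by
  obtain ⟨hfi, hD⟩ := hf
  have hGm : MeasurableSet G := hG.1.1.measurableSet
  have hμG : μ G < ∞ := hμ G (hΩb.subset hG.1.2.1)
  have : IsFiniteMeasure (μ.restrict G) := ⟨by simpa using hμG⟩
  refine ApproxBV.of_forall_exists fun B _ δ₀ hδ₀ => ?_
  -- The `L¹` distance collects three errors `δ` (threshold, approximation, truncation), and the
  -- energy bound loses `(2 + lam) δ`.
  set δ : ℝ≥0∞ := δ₀ / (3 + lam) with hδdef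
  have hδ : 0 < δ := ENNReal.div_pos hδ₀.ne' (by simp)
  have hδ3 : (3 + lam) * δ ≤ δ₀ := ENNReal.mul_div_le
  obtain ⟨M, hM, hfM⟩ := exists_trunc_approx hfi hδ
  obtain ⟨c, hc, hcG⟩ : ∃ c : ℝ, 0 < c ∧ ENNReal.ofReal c * μ G ≤ δ := by
    have h1 : Tendsto (fun n : ℕ => ENNReal.ofReal (1 / ((n : ℝ) + 1)) * μ G) atTop (𝓝 0) := by
      have := ENNReal.Tendsto.mul_const (b := μ G)
        (ENNReal.tendsto_ofReal tendsto_one_div_add_atTop_nhds_zero_nat) (Or.inr hμG.ne)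
      simpa using this
    obtain ⟨n, hn⟩ := ((ENNReal.tendsto_nhds_zero.1 h1) δ hδ).exists
    exact ⟨_, by positivity, hn⟩
  have hlt := ENNReal.lt_add_right hD.ne hδ.ne'
  conv_lhs at hlt => rw [totalVariation]
  simp only [totalVariationOpen, iInf_lt_iff] at hlt
  obtain ⟨A, ⟨hA, hGA⟩, u, ⟨hu, huf⟩, hlim⟩ := hlt
  have hrestrict : (μ.restrict G).restrict A = μ.restrict G := by
    rw [Measure.restrict_restrict hA.measurableSet, inter_eq_self_of_subset_right hGA]
  rw [hrestrict] at hlim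
  -- `A` has full measure for `μ.restrict G`, which is finite; after truncation, local convergence
  -- on `A` is therefore convergence in `L¹` on `G`.
  have hAc : μ.restrict G Aᶜ = 0 := by
    rw [Measure.restrict_apply hA.measurableSet.compl, ← sdiff_eq_compl_inter,
      sdiff_eq_empty.2 hGA, measure_empty]
  have hconv := (huf.comp_lipschitz (lipschitzWith_trunc M)).tendsto_lintegral hAc
    (M := (M + M).toNNReal) fun n x _ => by
      rw [Real.enorm_eq_ofReal_abs]
      exact ENNReal.ofReal_le_ofReal ((abs_sub _ _).trans
        (add_le_add (abs_trunc_le hM.le _) (abs_trunc_le hM.le _)))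
  obtain ⟨n, hn1, hn2⟩ := ((frequently_lt_of_liminf_lt (by isBoundedDefault) hlim).and_eventually
    ((ENNReal.tendsto_nhds_zero.1 hconv) δ hδ)).exists
  have hun := (locallyLipschitzOn_iff hA).1 (hu n)
  set v : X → ℝ := fun x => trunc M (u n x) with hv
  have hvL : LocallyLipschitzOn A v := (hu n).comp_lipschitzWith_one hA (lipschitzWith_trunc M)
  have hvlip' : ∫⁻ x in G, asympLip v x ∂μ < totalVariation (μ.restrict G) f G + δ :=
    (setLIntegral_mono' hGm fun x hx =>
      asympLip_comp_le_of_one (lipschitzWith_trunc M) (hun x (hGA hx))).trans_lt hn1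
  have hvlip := hvlip'.le
  have hvm : Measurable (G.indicator v) :=
    measurable_indicator_of_continuousOn hGm (hvL.continuousOn.mono hGA)
  have hva : AEMeasurable v (μ.restrict G) := (aemeasurable_indicator_iff hGm).1 hvm.aemeasurable
  have hfa : AEMeasurable (fun x => trunc M (f x)) (μ.restrict G) :=
    (lipschitzWith_trunc M).continuous.measurable.comp_aemeasurable hfi.aemeasurable
  have happ := hG.approxBV_indicator_softThreshold hμ hΩb hA hGA hvL hM hc
    (fun x => abs_trunc_le hM.le _) hvlip'.ne_top
  set s : X → ℝ := fun x => posPartSub c (v x) - posPartSub c (-v x) with hs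
  have hsa : AEMeasurable s (μ.restrict G) :=
    ((lipschitzWith_posPartSub c).continuous.sub
      (lipschitzWith_posPartSub_neg c).continuous).measurable.comp_aemeasurable hva
  refine ⟨G.indicator s, (aemeasurable_indicator_iff hGm).2 hsa, ?_, happ.mono ?_⟩
  · calc ∫⁻ x in B, ‖G.indicator s x - G.indicator f x‖ₑ ∂μ
        ≤ ∫⁻ x, G.indicator (fun x => ‖s x - f x‖ₑ) x ∂μ := by
          refine (setLIntegral_le_lintegral _ _).trans (lintegral_mono fun x => ?_)
          by_cases hx : x ∈ G <;> simp [hx]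
      _ = ∫⁻ x in G, ‖s x - f x‖ₑ ∂μ := lintegral_indicator hGm _
      _ ≤ ∫⁻ x in G, ‖s x - v x‖ₑ ∂μ + (∫⁻ x in G, ‖v x - trunc M (f x)‖ₑ ∂μ +
          ∫⁻ x in G, ‖trunc M (f x) - f x‖ₑ ∂μ) :=
        (lintegral_enorm_sub_le hsa hva).trans (by gcongr; exact lintegral_enorm_sub_le hva hfa)
      _ ≤ δ + (δ + δ) := by
        gcongr
        refine le_trans ?_ hcG
        rw [← setLIntegral_const]
        refine lintegral_mono fun x => ?_
        rw [Real.enorm_eq_ofReal_abs]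
        exact ENNReal.ofReal_le_ofReal (abs_posPartSub_sub_neg_sub_le hc.le _)
      _ = 3 * δ := by ring
      _ ≤ (3 + lam) * δ := by gcongr; exact le_self_add
      _ ≤ δ₀ := hδ3
  · have hvint : ∫⁻ x in G, ‖v x‖ₑ ∂μ ≤ δ + ∫⁻ x in G, ‖f x‖ₑ ∂μ := by
      have := lintegral_enorm_sub_le (c := fun _ => 0) hva hfa
      simp only [sub_zero] at this
      refine this.trans (add_le_add hn2 (lintegral_mono fun x => enorm_trunc_le hM.le _))
    calc _ ≤ 2 * (totalVariation (μ.restrict G) f G + δ) +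
          lam * (δ + ∫⁻ x in G, ‖f x‖ₑ ∂μ) := by gcongr
      _ = 2 * totalVariation (μ.restrict G) f G + lam * ∫⁻ x in G, ‖f x‖ₑ ∂μ +
          (2 + lam) * δ := by ring
      _ ≤ 2 * totalVariation (μ.restrict G) f G + lam * ∫⁻ x in G, ‖f x‖ₑ ∂μ +
          (3 + lam) * δ := by gcongr; norm_num
      _ ≤ _ := by gcongr

end Extension

end MetricBV

/-! ### The theorem. -/

open MetricBV in
theorem theorem3p4 {X : Type*} [MetricSpace X] [CompleteSpace X] [TopologicalSpace.SeparableSpace X]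
    [MeasurableSpace X] [BorelSpace X] (μ : Measure X)
    (hμ : ∀ s : Set X, Bornology.IsBounded s → μ s < ∞)
    (Ω : Set X) (hΩ : IsOpen Ω) (hΩb : Bornology.IsBounded Ω) (ε : ℝ) (hε : 0 < ε) :
    ∃ G : Set X, IsClosed G ∧ G ⊆ Ω ∧ μ (Ω \ G) < ENNReal.ofReal ε ∧
      ∃ lam : ℝ≥0, 0 < lam ∧ MetricBV.IsMinimalElement μ Ω lam G ∧
        ∀ f : X → ℝ, MetricBV.MemBV μ G f →
          MetricBV.MemBV μ univ (G.indicator f) ∧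
          MetricBV.bvNorm μ univ (G.indicator f) ≤
            ((max 2 (lam + 1) : ℝ≥0) : ℝ≥0∞) * MetricBV.bvNorm μ G f := by
  have : SecondCountableTopology X := UniformSpace.secondCountable_of_separable X
  set e : ℝ≥0∞ := ENNReal.ofReal ε with he
  have he0 : 0 < e := ENNReal.ofReal_pos.2 hε
  have he2 : e / 2 ≠ 0 := (ENNReal.half_pos he0.ne').ne'
  have he2t : e / 2 ≠ ∞ := ENNReal.div_ne_top ENNReal.ofReal_ne_top (by simp)
  obtain ⟨A, hAΩ, hAc, hAP, hAm⟩ :=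
    exists_closed_perimeter_lt_top hμ hΩ hΩb (ENNReal.half_pos he0.ne')
  -- Large enough for `Per(A) ≤ λ e / 2`; the added 1 keeps `λ` positive when the perimeter is 0.
  set lam : ℝ≥0 := (perimeter μ univ A / (e / 2)).toNNReal + 1 with hlam
  have hlam0 : (lam : ℝ≥0∞) ≠ 0 := by simp [hlam]
  have hlamP : perimeter μ univ A ≤ lam * (e / 2) := by
    rw [← ENNReal.div_le_iff he2 he2t, hlam, ENNReal.coe_add,
      ENNReal.coe_toNNReal (ENNReal.div_ne_top hAP.ne he2)]
    exact le_self_add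
  have hA : A ∈ competitors μ Ω lam := ⟨hAc, hAΩ, ENNReal.add_lt_top.2 ⟨hAP,
    ENNReal.mul_lt_top ENNReal.coe_lt_top ((measure_mono sdiff_subset).trans_lt (hμ Ω hΩb))⟩⟩
  obtain ⟨G, hG, hGA⟩ := exists_isMinimalElement hμ hΩb hA
  have hGm : MeasurableSet G := hG.1.1.measurableSet
  refine ⟨G, hG.1.1, hG.1.2.1, ?_, lam, by positivity, hG, fun f hf => ?_⟩
  · have h1 : lam * μ (Ω \ G) ≤ lam * (e / 2 + μ (Ω \ A)) :=
      calc lam * μ (Ω \ G) ≤ perimeterFunctional μ Ω lam G := le_add_self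
        _ ≤ perimeter μ univ A + lam * μ (Ω \ A) := hGA
        _ ≤ lam * (e / 2) + lam * μ (Ω \ A) := by gcongr
        _ = _ := by ring
    calc μ (Ω \ G) ≤ e / 2 + μ (Ω \ A) :=
          (ENNReal.mul_le_mul_iff_right hlam0 ENNReal.coe_ne_top).1 h1
      _ < e / 2 + e / 2 := ENNReal.add_lt_add_left he2t hAm
      _ = e := ENNReal.add_halves e
  · have hTV := (hG.approxBV_extension hμ hΩb hf).totalVariation_le
    have hfin : ∫⁻ x in G, ‖f x‖ₑ ∂μ < ∞ := hf.1.hasFiniteIntegral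
    have hN : eLpNorm (G.indicator f) 1 (μ.restrict univ) = ∫⁻ x in G, ‖f x‖ₑ ∂μ := by
      rw [Measure.restrict_univ, eLpNorm_indicator_eq_eLpNorm_restrict hGm,
        eLpNorm_one_eq_lintegral_enorm]
    refine ⟨⟨?_, hTV.trans_lt ?_⟩, ?_⟩
    · rw [Measure.restrict_univ, integrable_indicator_iff hGm]
      exact hf.1
    · exact ENNReal.add_lt_top.2 ⟨ENNReal.mul_lt_top (by simp) hf.2,
        ENNReal.mul_lt_top ENNReal.coe_lt_top hfin⟩
    · rw [bvNorm, bvNorm, hN, eLpNorm_one_eq_lintegral_enorm]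
      calc _ ≤ ∫⁻ x in G, ‖f x‖ₑ ∂μ + (2 * totalVariation (μ.restrict G) f G +
            lam * ∫⁻ x in G, ‖f x‖ₑ ∂μ) := by gcongr
        _ = (((lam + 1 : ℝ≥0)) : ℝ≥0∞) * ∫⁻ x in G, ‖f x‖ₑ ∂μ +
            ((2 : ℝ≥0) : ℝ≥0∞) * totalVariation (μ.restrict G) f G := by push_cast; ring
        _ ≤ ((max 2 (lam + 1) : ℝ≥0) : ℝ≥0∞) * ∫⁻ x in G, ‖f x‖ₑ ∂μ +
            ((max 2 (lam + 1) : ℝ≥0) : ℝ≥0∞) * totalVariation (μ.restrict G) f G := by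
          gcongr
          · exact le_max_right _ _
          · exact le_max_left _ _
        _ = _ := by rw [mul_add]
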